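/- Let $\mathbb{H}^2=\{x+iy : y>0\}$ be the upper half plane with the metric $(dx^2+dy^2)/y^2$ and distance $d$, on which $SL(2,\mathbb{R})$ acts by Möbius transformations, and let $Q=\{(z_1,z_2)\in\mathbb{H}^2\times\mathbb{H}^2 : z_1\ne z_2\}$ with the diagonal action. For $k,m_1,m_2>0$ the two-body problem is the Hamiltonian system on $T^*Q$ with Hamiltonian $h(p_q)=\frac12\|p_q\|^2-k\,m_1m_2\coth(d(z_1,z_2))$, $q=(z_1,z_2)$, where $\|\cdot\|$ is the norm dual to the kinetic metric $\langle\langle\cdot,\cdot\rangle\rangle=m_1\frac{dx_1^2+dy_1^2}{y_1^2}+m_2\frac{dx_2^2+dy_2^2}{y_2^2}$. A relative equilibrium is a solution $z:\mathbb{R}\to T^*Q$ of Hamilton's equations that is contained in a single orbit of the cotangent-lifted action of $SL(2,\mathbb{R})$. A pair $(q,\xi)\in Q\times\mathfrak{sl}(2,\mathbb{R})$ is called a relative equilibrium (with velocity $\xi$) if the curve $t\mapsto\exp(t\xi)\cdot\langle\langle\xi_Q(q),\cdot\rangle\rangle$ is a solution of Hamilton's equations, where $\xi_Q(q)=\frac{d}{dt}\big|_{t=0}\exp(t\xi)\cdot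 q$. Put $$\xi_e=\begin{pmatrix}0&-\frac12\\ \frac12&0\end{pmatrix},\qquad \xi_h=\begin{pmatrix}\frac12&0\\0&-\frac12\end{pmatrix},\qquad \xi_p=\begin{pmatrix}0&1\\0&0\end{pmatrix}.$$ A configuration $q$ is canonical, with angles $\theta_1,\theta_2\in(0,\frac\pi2)$, if $q=(\cos\theta_1+i\sin\theta_1,\,-\cos\theta_2+i\sin\theta_2)$ and $\frac{m_1}{m_2}=\frac{\cos\theta_2\sin^2\theta_1}{\sin^2\theta_2\cos\theta_1}$. For $\eta\in\{\xi_h,\xi_e\}$ let $\mathcal{F}_\eta$ be the set of all pairs $(g\cdot q,\,g(\omega\eta)g^{-1})$ with $g\in SL(2,\mathbb{R})$, $q$ canonical with angles $\theta_1,\theta_2$, and $\omega\in\mathbb{R}$ such that $$\omega^2=k\frac{\sin^2\theta_2\sin^2\theta_1}{(\cos\theta_2+\cos\theta_1)^2}\Big(\frac{\sin^2\theta_2}{\cos\theta_2}m_1\Big)=k\frac{\sin^2\theta_2\sin^2\theta_1}{(\cos\theta_2+\cos\theta_1)^2}\Big(\frac{\sin^2\theta_1}{\cos\theta_1}m_2\Big).\qquad(*)$$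 Theorem. For all $k,m_1,m_2>0$ the following hold. 1. A curve $z:\mathbb{R}\to T^*Q$ is a relative equilibrium if and only if $z(t)=\exp(t\xi)\cdot\langle\langle\xi_Q(q),\cdot\rangle\rangle$ for all $t$, for a unique pair $(q,\xi)$ that is a relative equilibrium. 2. Every $q\in Q$ lies in the $SL(2,\mathbb{R})$-orbit of a canonical configuration, whose angles $(\theta_1,\theta_2)$ are uniquely determined by $q$. 3. If $q$ is canonical with angles $\theta_1,\theta_2$, then $(q,\xi)$ is a relative equilibrium if and only if $\xi=\omega\xi_h$ or $\xi=\omega\xi_e$ for some real $\omega$ satisfying $(*)$. 4. There are exactly two families of relative equilibria: a pair $(q,\xi)$ is a relative equilibrium if and only if it lies in $\mathcal{F}_{\xi_h}\cup\mathcal{F}_{\xi_e}$; the two families are disjoint, and for every $q\in Q$ each of them contains a pair $(q,\xi)$. 5. All velocities in $\mathcal{F}_{\xi_h}$ are hyperbolic (two distinct real eigenvalues) and all velocities in $\mathcal{F}_{\xi_e}$ are elliptic (two distinct non-real eigenvalues). No pair $(q,\xi)$ with $\xi$ parabolic (non-zero nilpotent) is a relative equilibrium, and if $q$ is canonical then $(q,\omega(\xi_e+\xi_p))$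 is not a relative equilibrium for any $\omega\in\mathbb{R}$. -/

import Mathlib

open UpperHalfPlane
open scoped MatrixGroups

noncomputable section

namespace HypTwoBody

/-! ### The group `SL(2, ℝ)` and its Lie algebra -/

/-- The Lie algebra `𝔰𝔩(2, ℝ)` of traceless real `2 × 2` matrices. -/
abbrev sl2 : Type := LieAlgebra.SpecialLinear.sl (Fin 2) ℝ

theorem trace_sl2 (ξ : sl2) : Matrix.trace (ξ : Matrix (Fin 2) (Fin 2) ℝ) = 0 :=
  LinearMap.mem_ker.mp ξ.2

/-- A traceless matrix as an element of `𝔰𝔩(2, ℝ)`. -/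
def mkSl2 (a b c : ℝ) : sl2 :=
  ⟨!![a, b; c, -a], LinearMap.mem_ker.mpr (by simp [Matrix.trace_fin_two])⟩

/-- The elliptic generator `ξ_e`. -/
def xiE : sl2 := mkSl2 0 (-1 / 2) (1 / 2)

/-- The hyperbolic generator `ξ_h`. -/
def xiH : sl2 := mkSl2 (1 / 2) 0 0

/-- The parabolic generator `ξ_p`. -/
def xiP : sl2 := mkSl2 0 1 0

theorem det_exp_sl2 (ξ : sl2) :
    (NormedSpace.exp (ξ : Matrix (Fin 2) (Fin 2) ℝ)).det = 1 := by
  obtain ⟨A, hA⟩ : ∃ A : Matrix (Fin 2) (Fin 2) ℝ, A = ξ := ⟨_, rfl⟩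
  have htr : A 0 0 + A 1 1 = 0 := by
    have h := trace_sl2 ξ
    rw [← hA, Matrix.trace_fin_two] at h
    exact h
  rw [← hA]
  let U : (Matrix (Fin 2) (Fin 2) ℝ)ˣ :=
    ⟨!![0, 1; -1, 0], !![0, -1; 1, 0],
      by ext i j; fin_cases i <;> fin_cases j <;> simp,
      by ext i j; fin_cases i <;> fin_cases j <;> simp⟩
  have hconj : ∀ B : Matrix (Fin 2) (Fin 2) ℝ,
      (U : Matrix (Fin 2) (Fin 2) ℝ) * B.transpose * (U⁻¹ : (Matrix (Fin 2) (Fin 2) ℝ)ˣ) =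
        B.adjugate := by
    intro B
    change !![0, 1; -1, 0] * B.transpose * !![0, -1; 1, 0] = B.adjugate
    rw [Matrix.adjugate_fin_two]
    ext i j
    fin_cases i <;> fin_cases j <;> simp [Matrix.mul_apply, Matrix.vecMul, dotProduct, Fin.sum_univ_two]
  have hadj : A.adjugate = -A := by
    rw [Matrix.adjugate_fin_two]
    ext i j
    fin_cases i <;> fin_cases j <;> simp <;> linarith
  have h1 : NormedSpace.exp (-A) = (NormedSpace.exp A).adjugate := by
    rw [← hadj, ← hconj A, Matrix.exp_units_conj, Matrix.exp_transpose, hconj]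
  have hne : (NormedSpace.exp A).det ≠ 0 :=
    ((Matrix.isUnit_iff_isUnit_det _).mp (Matrix.isUnit_exp A)).ne_zero
  have h2 : NormedSpace.exp A * (NormedSpace.exp A).adjugate = 1 := by
    rw [← h1, Matrix.exp_neg, Matrix.mul_nonsing_inv _ (isUnit_iff_ne_zero.mpr hne)]
  rw [Matrix.mul_adjugate] at h2
  have h3 := congrFun (congrFun h2 0) 0
  simpa using h3

/-- The exponential map `exp : 𝔰𝔩(2, ℝ) → SL(2, ℝ)`. -/
def expSL (ξ : sl2) : SL(2, ℝ) :=
  ⟨NormedSpace.exp (ξ : Matrix (Fin 2) (Fin 2) ℝ), det_exp_sl2 ξ⟩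

/-- The adjoint action `Ad_g ξ = g ξ g⁻¹`. -/
def Ad (g : SL(2, ℝ)) (ξ : sl2) : sl2 :=
  ⟨(g : Matrix (Fin 2) (Fin 2) ℝ) * ξ * ((g⁻¹ : SL(2, ℝ)) : Matrix (Fin 2) (Fin 2) ℝ),
    LinearMap.mem_ker.mpr (by
      rw [Matrix.traceLinearMap_apply, Matrix.trace_mul_comm, ← mul_assoc, ← Matrix.SpecialLinearGroup.coe_mul,
        inv_mul_cancel, Matrix.SpecialLinearGroup.coe_one, one_mul]
      exact trace_sl2 ξ)⟩

/-! ### Configuration space and phase space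

A tangent vector `(u_x, u_y)` of the upper half plane is written as `u_x + i u_y`, a covector
`p_x dx + p_y dy` as `p_x + i p_y`. -/

/-- The pairing `p_x u_x + p_y u_y` of a covector with a tangent vector. -/
def pair (p u : ℂ) : ℝ := p.re * u.re + p.im * u.im

/-- The configuration space: ordered pairs of distinct points of the hyperbolic plane `ℍ`. -/
def Config : Type := {q : ℍ × ℍ // q.1 ≠ q.2}

/-- The position of the first mass. -/
def Config.pos₁ (q : Config) : ℍ := q.1.1

/-- The position of the second mass. -/
def Config.pos₂ (q : Config) : ℍ := q.1.2

/-- The diagonal action of `SL(2, ℝ)` by Möbius transformations. -/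
instance : MulAction SL(2, ℝ) Config where
  smul g q := ⟨(g • q.pos₁, g • q.pos₂), fun h => q.2 (smul_left_cancel g h)⟩
  one_smul q := Subtype.ext (Prod.ext (one_smul SL(2, ℝ) q.pos₁) (one_smul SL(2, ℝ) q.pos₂))
  mul_smul g h q := Subtype.ext (Prod.ext (mul_smul g h q.pos₁) (mul_smul g h q.pos₂))

/-- The cotangent bundle of the configuration space. -/
@[ext] structure Phase where
  /-- the configuration -/
  q : Config
  /-- the momentum of the first mass -/
  p₁ : ℂ
  /-- the momentum of the second mass -/
  p₂ : ℂ

/-- The cotangent coordinates of a point of the phase space. -/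
def Phase.coords (z : Phase) : (ℂ × ℂ) × (ℂ × ℂ) :=
  (((z.q.pos₁ : ℂ), (z.q.pos₂ : ℂ)), (z.p₁, z.p₂))

/-- The cotangent lift of the Möbius transformation `g = (a b; c d)`: the derivative of `g` at `x`
is multiplication by `(c x + d)⁻²`, and the covector `p` at `x` is sent to the covector
`p ∘ (D_x g)⁻¹` at `g • x` (see `hasDerivAt_moebius` and `pair_liftCovector`). -/
def liftCovector (g : SL(2, ℝ)) (x : ℍ) (p : ℂ) : ℂ :=
  p * (starRingEnd ℂ) (((g 1 0 : ℝ) : ℂ) * (x : ℂ) + ((g 1 1 : ℝ) : ℂ)) ^ 2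

theorem coe_smul_eq (g : SL(2, ℝ)) (x : ℍ) :
    ((g • x : ℍ) : ℂ) = (((g 0 0 : ℝ) : ℂ) * (x : ℂ) + ((g 0 1 : ℝ) : ℂ)) /
      (((g 1 0 : ℝ) : ℂ) * (x : ℂ) + ((g 1 1 : ℝ) : ℂ)) := by
  simpa using UpperHalfPlane.coe_specialLinearGroup_apply g x

theorem denom_ne (g : SL(2, ℝ)) (x : ℍ) :
    ((g 1 0 : ℝ) : ℂ) * (x : ℂ) + ((g 1 1 : ℝ) : ℂ) ≠ 0 := by
  simpa [UpperHalfPlane.denom] using UpperHalfPlane.denom_ne_zero (g : GL (Fin 2) ℝ) x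

theorem hasDerivAt_moebius (g : SL(2, ℝ)) (x : ℍ) :
    HasDerivAt (fun w : ℂ => ((g • ofComplex w : ℍ) : ℂ))
      (1 / (((g 1 0 : ℝ) : ℂ) * (x : ℂ) + ((g 1 1 : ℝ) : ℂ)) ^ 2) (x : ℂ) := by
  have hdet : ((g 0 0 : ℝ) : ℂ) * ((g 1 1 : ℝ) : ℂ) - ((g 0 1 : ℝ) : ℂ) * ((g 1 0 : ℝ) : ℂ) = 1 := by
    have h := g.2
    rw [Matrix.det_fin_two] at h
    exact_mod_cast h
  have hn : HasDerivAt (fun w : ℂ => ((g 0 0 : ℝ) : ℂ) * w + ((g 0 1 : ℝ) : ℂ))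
      ((g 0 0 : ℝ) : ℂ) (x : ℂ) := by
    simpa only [mul_one, id] using! ((hasDerivAt_id (x : ℂ)).const_mul ((g 0 0 : ℝ) : ℂ)).add_const ((g 0 1 : ℝ) : ℂ)
  have hd : HasDerivAt (fun w : ℂ => ((g 1 0 : ℝ) : ℂ) * w + ((g 1 1 : ℝ) : ℂ))
      ((g 1 0 : ℝ) : ℂ) (x : ℂ) := by
    simpa only [mul_one, id] using! ((hasDerivAt_id (x : ℂ)).const_mul ((g 1 0 : ℝ) : ℂ)).add_const ((g 1 1 : ℝ) : ℂ)
  have h := hn.div hd (denom_ne g x)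
  have h' := h.congr_of_eventuallyEq
    (f₁ := fun w : ℂ => ((g • ofComplex w : ℍ) : ℂ)) (by
      filter_upwards [isOpen_lt continuous_const Complex.continuous_im |>.mem_nhds x.im_pos]
        with w hw
      simp only [Pi.div_apply]
      rw [coe_smul_eq, ofComplex_apply_of_im_pos hw])
  refine h'.congr_deriv ?_
  congr 1
  linear_combination hdet

theorem pair_liftCovector (g : SL(2, ℝ)) (x : ℍ) (p u : ℂ) :
    pair (liftCovector g x p)
      (1 / (((g 1 0 : ℝ) : ℂ) * (x : ℂ) + ((g 1 1 : ℝ) : ℂ)) ^ 2 * u) = pair p u := by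
  have hp : ∀ a b : ℂ, pair a b = ((starRingEnd ℂ) a * b).re := by
    intro a b
    simp [pair]
  rw [hp, hp]
  congr 1
  have h := denom_ne g x
  simp only [liftCovector, map_mul, map_pow, Complex.conj_conj]
  field_simp

theorem denom_cocycle_sl (g h : SL(2, ℝ)) (x : ℍ) :
    ((((g * h) 1 0 : ℝ) : ℂ) * (x : ℂ) + (((g * h) 1 1 : ℝ) : ℂ)) =
      (((g 1 0 : ℝ) : ℂ) * ((h • x : ℍ) : ℂ) + ((g 1 1 : ℝ) : ℂ)) *
        (((h 1 0 : ℝ) : ℂ) * (x : ℂ) + ((h 1 1 : ℝ) : ℂ)) := by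
  have hd := denom_ne h x
  rw [coe_smul_eq, Matrix.SpecialLinearGroup.coe_mul]
  simp only [Matrix.mul_apply, Fin.sum_univ_two]
  push_cast
  field_simp
  ring

/-- The cotangent lift of the diagonal action of `SL(2, ℝ)`. -/
instance : MulAction SL(2, ℝ) Phase where
  smul g z := ⟨g • z.q, liftCovector g z.q.pos₁ z.p₁, liftCovector g z.q.pos₂ z.p₂⟩
  one_smul z := by
    refine Phase.ext (one_smul SL(2, ℝ) z.q) ?_ ?_
    · change liftCovector 1 z.q.pos₁ z.p₁ = z.p₁
      simp [liftCovector]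
    · change liftCovector 1 z.q.pos₂ z.p₂ = z.p₂
      simp [liftCovector]
  mul_smul g h z := by
    refine Phase.ext (mul_smul g h z.q) ?_ ?_
    · change liftCovector (g * h) z.q.pos₁ z.p₁ =
        liftCovector g (h • z.q.pos₁) (liftCovector h z.q.pos₁ z.p₁)
      simp only [liftCovector, denom_cocycle_sl, map_mul]
      ring
    · change liftCovector (g * h) z.q.pos₂ z.p₂ =
        liftCovector g (h • z.q.pos₂) (liftCovector h z.q.pos₂ z.p₂)
      simp only [liftCovector, denom_cocycle_sl, map_mul]
      ring

/-! ### Dynamics -/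

/-- The potential `V(d) = - k m₁ m₂ coth d`. -/
def potential (k m₁ m₂ d : ℝ) : ℝ := -k * m₁ * m₂ * (Real.cosh d / Real.sinh d)

/-- The Hamiltonian in cotangent coordinates: `½ ‖p‖² + V`, where `‖·‖` is the norm on covectors
dual to the kinetic metric `m₁ (dx₁² + dy₁²) / y₁² + m₂ (dx₂² + dy₂²) / y₂²`, and where
`V` is evaluated at the hyperbolic distance of the two masses. -/
def hamiltonian (k m₁ m₂ : ℝ) (w : (ℂ × ℂ) × (ℂ × ℂ)) : ℝ :=
  (1 / 2) * (w.1.1.im ^ 2 * Complex.normSq w.2.1 / m₁ + w.1.2.im ^ 2 * Complex.normSq w.2.2 / m₂) +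
    potential k m₁ m₂ (dist (ofComplex w.1.1) (ofComplex w.1.2))

/-- The canonical symplectic form `dq ∧ dp` of the cotangent bundle. -/
def sympForm (X v : (ℂ × ℂ) × (ℂ × ℂ)) : ℝ :=
  (pair v.2.1 X.1.1 + pair v.2.2 X.1.2) - (pair X.2.1 v.1.1 + pair X.2.2 v.1.2)

/-- `z` is a solution of Hamilton's equations `q' = ∂H/∂p`, `p' = - ∂H/∂q`. -/
def IsSolution (k m₁ m₂ : ℝ) (z : ℝ → Phase) : Prop :=
  ∀ t : ℝ, ∃ X : (ℂ × ℂ) × (ℂ × ℂ), HasDerivAt (fun s => (z s).coords) X t ∧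
    ∀ v, sympForm X v = fderiv ℝ (hamiltonian k m₁ m₂) (z t).coords v

/-- A relative equilibrium is a solution that is contained in a group orbit. -/
def IsRelativeEquilibrium (k m₁ m₂ : ℝ) (z : ℝ → Phase) : Prop :=
  IsSolution k m₁ m₂ z ∧ ∃ z₀ : Phase, ∀ t, z t ∈ MulAction.orbit SL(2, ℝ) z₀

/-- The infinitesimal generator of the action of `SL(2, ℝ)` on `ℍ` defined by `ξ`, at `x`. -/
def generator (ξ : sl2) (x : ℍ) : ℂ :=
  deriv (fun t : ℝ => ((expSL (t • ξ) • x : ℍ) : ℂ)) 0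

/-- The covector `⟨⟨ξ_Q(q), ·⟩⟩` at `q`, where `⟨⟨·, ·⟩⟩` is the kinetic metric. -/
def momentumOf (m₁ m₂ : ℝ) (q : Config) (ξ : sl2) : Phase where
  q := q
  p₁ := ((m₁ / q.pos₁.im ^ 2 : ℝ) : ℂ) * generator ξ q.pos₁
  p₂ := ((m₂ / q.pos₂.im ^ 2 : ℝ) : ℂ) * generator ξ q.pos₂

/-- The curve `t ↦ exp(t ξ) · ⟨⟨ξ_Q(q), ·⟩⟩` in phase space. -/
def motion (m₁ m₂ : ℝ) (q : Config) (ξ : sl2) (t : ℝ) : Phase :=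
  expSL (t • ξ) • momentumOf m₁ m₂ q ξ

/-- The pair `(q, ξ)` is a relative equilibrium, with velocity `ξ`: the curve
`exp(t ξ) · ⟨⟨ξ_Q(q), ·⟩⟩` solves the equations of motion. -/
def IsRelEqPair (k m₁ m₂ : ℝ) (q : Config) (ξ : sl2) : Prop :=
  IsSolution k m₁ m₂ (motion m₁ m₂ q ξ)

/-! ### Canonical configurations and the two families -/

/-- `q` is the canonical configuration with angles `θ₁`, `θ₂`. -/
def IsCanonical (m₁ m₂ θ₁ θ₂ : ℝ) (q : Config) : Prop :=
  0 < θ₁ ∧ θ₁ < Real.pi / 2 ∧ 0 < θ₂ ∧ θ₂ < Real.pi / 2 ∧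
    (q.pos₁ : ℂ) = ⟨Real.cos θ₁, Real.sin θ₁⟩ ∧
    (q.pos₂ : ℂ) = ⟨-Real.cos θ₂, Real.sin θ₂⟩ ∧
    m₁ / m₂ = (Real.cos θ₂ * Real.sin θ₁ ^ 2) / (Real.sin θ₂ ^ 2 * Real.cos θ₁)

/-- The condition on the angular velocity `ω` in the canonical configuration. -/
def OmegaCondition (k m₁ m₂ θ₁ θ₂ ω : ℝ) : Prop :=
  ω ^ 2 = k * (Real.sin θ₂ ^ 2 * Real.sin θ₁ ^ 2 / (Real.cos θ₂ + Real.cos θ₁) ^ 2) *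
      (Real.sin θ₂ ^ 2 / Real.cos θ₂ * m₁) ∧
    ω ^ 2 = k * (Real.sin θ₂ ^ 2 * Real.sin θ₁ ^ 2 / (Real.cos θ₂ + Real.cos θ₁) ^ 2) *
      (Real.sin θ₁ ^ 2 / Real.cos θ₁ * m₂)

/-- The family of pairs generated by `η`: all pairs `(g • q₀, Ad_g (ω η))`, where `q₀` is a
canonical configuration, `ω` satisfies the condition above, and `g ∈ SL(2, ℝ)`. -/
def relEqFamily (k m₁ m₂ : ℝ) (η : sl2) : Set (Config × sl2) :=
  {x | ∃ (θ₁ θ₂ ω : ℝ) (q₀ : Config) (g : SL(2, ℝ)), IsCanonical m₁ m₂ θ₁ θ₂ q₀ ∧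
    OmegaCondition k m₁ m₂ θ₁ θ₂ ω ∧ x = (g • q₀, Ad g (ω • η))}

end HypTwoBody

end

noncomputable section

namespace HypTwoBody

/-! ### The infinitesimal action -/

/-! The proof turns Hamilton's equations into algebra at a single configuration. The matrix `(a b; c
-a)` generates the holomorphic field `quad`, and along its flow the covariant acceleration is `i ·
quad · polar / y`. Equating it with the gradient of the potential gives two complex equations,
`Balance`. These are equivariant under `SL(2, ℝ)`, and `exp(tξ)` fixes `ξ`, so they hold for all
times as soon as they hold at time zero (`isRelEqPair_iff`).

In a canonical configuration both masses lie on the unit circle, the geodesic orthogonal to the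
imaginary axis at `i`. There each equation is divisible by the position and splits into two real
ones (`balanceAt_unit_iff`). Since the force does not vanish, `c = -b`; eliminating the force then
gives `ab = 0` (`balance_algebra`). What remains is translation along the imaginary axis or rotation
about `i`, with the prescribed speed.

Every configuration can be made canonical because the distance is a complete invariant of ordered
pairs (`exists_smul_eq_of_dist_eq`). If `s₁`, `s₂` are the distances of the masses to `i`, then
`sinh sⱼ = cot θⱼ`, and the mass condition becomes `m₁ sinh 2s₁ = m₂ sinh 2s₂` with `s₁ + s₂ = d`.
By monotonicity this has exactly one solution.

A solution contained in an orbit need not come with a differentiable choice of group elements.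
Instead, each momentum is a constant complex multiple of the equivariant covector `dir`. The
positions therefore solve an autonomous equation, which is also solved by a one-parameter motion;
uniqueness identifies the two (`exists_eq_motion`). Finally, the sign of the discriminant, a
conjugation invariant, separates the families and excludes parabolic velocities. -/

theorem sl2_apply_one_one (ξ : sl2) : (ξ : Matrix (Fin 2) (Fin 2) ℝ) 1 1 = -ξ.1 0 0 := by
  have h := trace_sl2 ξ
  rw [Matrix.trace_fin_two] at h
  linarith

theorem sl2_ext {ξ η : sl2} (h₀ : ξ.1 0 0 = η.1 0 0) (h₁ : ξ.1 0 1 = η.1 0 1)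
    (h₂ : ξ.1 1 0 = η.1 1 0) : ξ = η := by
  apply Subtype.ext
  ext i j
  fin_cases i <;> fin_cases j
  · exact h₀
  · exact h₁
  · exact h₂
  · exact (sl2_apply_one_one ξ).trans ((congrArg Neg.neg h₀).trans (sl2_apply_one_one η).symm)

/-- The holomorphic vector field `b + 2 a w - c w²` generated by `(a b; c -a)`. -/
def quad (ξ : sl2) (w : ℂ) : ℂ :=
  ((ξ.1 0 1 : ℝ) : ℂ) + 2 * ((ξ.1 0 0 : ℝ) : ℂ) * w - ((ξ.1 1 0 : ℝ) : ℂ) * w ^ 2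

/-- The polarization `b + 2 a Re w - c |w|²` of `quad`. -/
def polar (ξ : sl2) (w : ℂ) : ℝ :=
  ξ.1 0 1 + 2 * ξ.1 0 0 * w.re - ξ.1 1 0 * (w.re ^ 2 + w.im ^ 2)

theorem polar_eq (ξ : sl2) (w : ℂ) : ((polar ξ w : ℝ) : ℂ) =
    ((ξ.1 0 1 : ℝ) : ℂ) + ((ξ.1 0 0 : ℝ) : ℂ) * (w + (starRingEnd ℂ) w) -
      ((ξ.1 1 0 : ℝ) : ℂ) * (w * (starRingEnd ℂ) w) := by
  rw [Complex.mul_conj, Complex.add_conj, Complex.normSq_apply, polar]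
  push_cast
  ring

/-- The automorphy factor `c z + d`. -/
def den (g : SL(2, ℝ)) (x : ℍ) : ℂ :=
  ((g 1 0 : ℝ) : ℂ) * (x : ℂ) + ((g 1 1 : ℝ) : ℂ)

theorem den_ne_zero (g : SL(2, ℝ)) (x : ℍ) : den g x ≠ 0 := denom_ne g x

theorem conj_den_ne_zero (g : SL(2, ℝ)) (x : ℍ) : (starRingEnd ℂ) (den g x) ≠ 0 :=
  (map_ne_zero _).mpr (den_ne_zero g x)

theorem conj_den (g : SL(2, ℝ)) (x : ℍ) : (starRingEnd ℂ) (den g x) =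
    ((g 1 0 : ℝ) : ℂ) * (starRingEnd ℂ) (x : ℂ) + ((g 1 1 : ℝ) : ℂ) := by
  simp [den]

theorem liftCovector_eq (g : SL(2, ℝ)) (x : ℍ) (p : ℂ) :
    liftCovector g x p = p * (starRingEnd ℂ) (den g x) ^ 2 := rfl

theorem coe_smul_den (g : SL(2, ℝ)) (x : ℍ) :
    ((g • x : ℍ) : ℂ) = (((g 0 0 : ℝ) : ℂ) * (x : ℂ) + ((g 0 1 : ℝ) : ℂ)) / den g x :=
  coe_smul_eq g x

theorem conj_smul_den (g : SL(2, ℝ)) (x : ℍ) : (starRingEnd ℂ) ((g • x : ℍ) : ℂ) =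
    (((g 0 0 : ℝ) : ℂ) * (starRingEnd ℂ) (x : ℂ) + ((g 0 1 : ℝ) : ℂ)) /
      (starRingEnd ℂ) (den g x) := by
  simp [coe_smul_den]

theorem det_SL_two (g : SL(2, ℝ)) :
    ((g 0 0 : ℝ) : ℂ) * ((g 1 1 : ℝ) : ℂ) - ((g 0 1 : ℝ) : ℂ) * ((g 1 0 : ℝ) : ℂ) = 1 := by
  have h := g.2
  rw [Matrix.det_fin_two] at h
  exact_mod_cast h

theorem coe_smul_sub_coe_smul (g : SL(2, ℝ)) (x y : ℍ) :
    ((g • x : ℍ) : ℂ) - ((g • y : ℍ) : ℂ) = ((x : ℂ) - y) / (den g x * den g y) := by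
  rw [coe_smul_den, coe_smul_den, div_sub_div _ _ (den_ne_zero g x) (den_ne_zero g y)]
  congr 1
  simp only [den]
  linear_combination ((x : ℂ) - y) * det_SL_two g

theorem coe_smul_sub_conj_smul (g : SL(2, ℝ)) (x y : ℍ) :
    ((g • x : ℍ) : ℂ) - (starRingEnd ℂ) ((g • y : ℍ) : ℂ) =
      ((x : ℂ) - (starRingEnd ℂ) (y : ℂ)) / (den g x * (starRingEnd ℂ) (den g y)) := by
  rw [coe_smul_den, conj_smul_den,
    div_sub_div _ _ (den_ne_zero g x) (conj_den_ne_zero g y)]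
  congr 1
  rw [conj_den]
  simp only [den]
  linear_combination ((x : ℂ) - (starRingEnd ℂ) (y : ℂ)) * det_SL_two g

theorem im_smul_den (g : SL(2, ℝ)) (x : ℍ) : (((g • x : ℍ).im : ℝ) : ℂ) =
    ((x.im : ℝ) : ℂ) / (den g x * (starRingEnd ℂ) (den g x)) := by
  have h : ∀ w : ℍ, ((w.im : ℝ) : ℂ) = ((w : ℂ) - (starRingEnd ℂ) (w : ℂ)) / (2 * Complex.I) := by
    intro w
    rw [Complex.sub_conj, coe_im]
    field_simp
    push_cast
    ring
  rw [h, h, coe_smul_sub_conj_smul]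
  ring

/-! ### Equivariance of the generating field and its polarization. -/

theorem Ad_entries (g : SL(2, ℝ)) (ξ : sl2) :
    (Ad g ξ).1 0 0 = (g 0 0 * g 1 1 + g 0 1 * g 1 0) * ξ.1 0 0 - g 0 0 * g 1 0 * ξ.1 0 1 +
      g 0 1 * g 1 1 * ξ.1 1 0 ∧
    (Ad g ξ).1 0 1 = -2 * g 0 0 * g 0 1 * ξ.1 0 0 + g 0 0 ^ 2 * ξ.1 0 1 - g 0 1 ^ 2 * ξ.1 1 0 ∧
    (Ad g ξ).1 1 0 = 2 * g 1 0 * g 1 1 * ξ.1 0 0 - g 1 0 ^ 2 * ξ.1 0 1 + g 1 1 ^ 2 * ξ.1 1 0 := by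
  refine ⟨?_, ?_, ?_⟩ <;>
  · simp only [Ad, Matrix.SpecialLinearGroup.coe_inv, Matrix.adjugate_fin_two, Matrix.mul_apply,
      Fin.sum_univ_two, sl2_apply_one_one]
    simp
    ring

theorem quad_Ad (g : SL(2, ℝ)) (ξ : sl2) (x : ℍ) :
    quad (Ad g ξ) ((g • x : ℍ) : ℂ) = quad ξ x / den g x ^ 2 := by
  obtain ⟨h₀, h₁, h₂⟩ := Ad_entries g ξ
  have hd := den_ne_zero g x
  have hdet := det_SL_two g
  rw [coe_smul_den]
  simp only [quad, h₀, h₁, h₂]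
  push_cast
  field_simp
  simp only [den]
  have h2 := congrArg (fun z : ℂ => z ^ 2) hdet
  simp only [one_pow] at h2
  linear_combination (((ξ.1 0 1 : ℝ) : ℂ) + 2 * ((ξ.1 0 0 : ℝ) : ℂ) * x -
    ((ξ.1 1 0 : ℝ) : ℂ) * (x : ℂ) ^ 2) * h2

/-- Replacing `w²` by `w · conj w` in `quad` replaces one of the two automorphy factors by its
conjugate; both identities reduce to the square of the determinant equation. -/
theorem polar_Ad (g : SL(2, ℝ)) (ξ : sl2) (x : ℍ) :
    ((polar (Ad g ξ) ((g • x : ℍ) : ℂ) : ℝ) : ℂ) =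
      ((polar ξ x : ℝ) : ℂ) / (den g x * (starRingEnd ℂ) (den g x)) := by
  obtain ⟨h₀, h₁, h₂⟩ := Ad_entries g ξ
  have hd := den_ne_zero g x
  have hd' := conj_den_ne_zero g x
  have hdet := det_SL_two g
  rw [polar_eq, polar_eq, conj_smul_den, coe_smul_den]
  simp only [h₀, h₁, h₂]
  push_cast
  field_simp
  rw [conj_den]
  simp only [den]
  have h2 := congrArg (fun z : ℂ => z ^ 2) hdet
  simp only [one_pow] at h2
  linear_combination (((ξ.1 0 1 : ℝ) : ℂ) + ((ξ.1 0 0 : ℝ) : ℂ) * (x + (starRingEnd ℂ) (x : ℂ)) -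
    ((ξ.1 1 0 : ℝ) : ℂ) * (x * (starRingEnd ℂ) (x : ℂ))) * h2

/-! ### One-parameter groups and their flow on the half plane. -/

section exp

attribute [local instance] Matrix.linftyOpNormedRing Matrix.linftyOpNormedAlgebra

theorem hasDerivAt_expSL_apply (ξ : sl2) (t : ℝ) (i j : Fin 2) :
    HasDerivAt (fun s : ℝ => (expSL (s • ξ)) i j)
      (ξ.1 i 0 * (expSL (t • ξ)) 0 j + ξ.1 i 1 * (expSL (t • ξ)) 1 j) t := by
  have h := hasDerivAt_exp_smul_const' (𝕂 := ℝ) (ξ : Matrix (Fin 2) (Fin 2) ℝ) t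
  let e : Matrix (Fin 2) (Fin 2) ℝ →ₗ[ℝ] ℝ :=
    { toFun := fun M => M i j, map_add' := fun _ _ => rfl, map_smul' := fun _ _ => rfl }
  have h' := (LinearMap.toContinuousLinearMap e).hasFDerivAt.comp_hasDerivAt t h
  refine h'.congr_deriv ?_
  change ((ξ : Matrix (Fin 2) (Fin 2) ℝ) * NormedSpace.exp (t • (ξ : Matrix (Fin 2) (Fin 2) ℝ))) i j
    = _
  rw [Matrix.mul_apply, Fin.sum_univ_two]
  rfl

theorem expSL_zero_smul (ξ : sl2) : expSL ((0 : ℝ) • ξ) = 1 := by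
  apply Subtype.ext
  change NormedSpace.exp ((0 : ℝ) • (ξ : Matrix (Fin 2) (Fin 2) ℝ)) = 1
  rw [zero_smul, NormedSpace.exp_zero]

theorem Ad_expSL_self (ξ : sl2) (t : ℝ) : Ad (expSL (t • ξ)) ξ = ξ := by
  apply Subtype.ext
  change NormedSpace.exp (t • (ξ : Matrix (Fin 2) (Fin 2) ℝ)) * (ξ : Matrix (Fin 2) (Fin 2) ℝ) *
    ((expSL (t • ξ))⁻¹ : SL(2, ℝ)).1 = ξ
  have hc : Commute (NormedSpace.exp (t • (ξ : Matrix (Fin 2) (Fin 2) ℝ)))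
      (ξ : Matrix (Fin 2) (Fin 2) ℝ) :=
    ((Commute.refl (ξ : Matrix (Fin 2) (Fin 2) ℝ)).smul_left t).exp_left
  rw [hc.eq, mul_assoc]
  have : NormedSpace.exp (t • (ξ : Matrix (Fin 2) (Fin 2) ℝ)) *
      ((expSL (t • ξ))⁻¹ : SL(2, ℝ)).1 = 1 :=
    congrArg Subtype.val (mul_inv_cancel (expSL (t • ξ)))
  rw [this, mul_one]

end exp

theorem hasDerivAt_expSL_smul (ξ : sl2) (x : ℍ) (t : ℝ) :
    HasDerivAt (fun s : ℝ => ((expSL (s • ξ) • x : ℍ) : ℂ))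
      (quad ξ ((expSL (t • ξ) • x : ℍ) : ℂ)) t := by
  have h := fun i j => (hasDerivAt_expSL_apply ξ t i j).ofReal_comp
  have hn := ((h 0 0).mul_const (x : ℂ)).add (h 0 1)
  have hd := ((h 1 0).mul_const (x : ℂ)).add (h 1 1)
  have hq := hn.div hd (den_ne_zero _ x)
  have hd0 := den_ne_zero (expSL (t • ξ)) x
  refine (hq.congr_of_eventuallyEq (Filter.Eventually.of_forall fun s => ?_)).congr_deriv ?_
  · exact coe_smul_eq _ x
  · rw [quad, coe_smul_den]
    simp only [Pi.add_apply, sl2_apply_one_one]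
    simp only [den] at hd0 ⊢
    push_cast
    field_simp
    ring

theorem generator_eq (ξ : sl2) (x : ℍ) : generator ξ x = quad ξ x := by
  have h := (hasDerivAt_expSL_smul ξ x 0).deriv
  rwa [expSL_zero_smul, one_smul] at h

theorem Ad_mul (g h : SL(2, ℝ)) (ξ : sl2) : Ad (g * h) ξ = Ad g (Ad h ξ) := by
  apply Subtype.ext
  simp only [Ad, mul_inv_rev, Matrix.SpecialLinearGroup.coe_mul]
  simp only [mul_assoc]

theorem Ad_one (ξ : sl2) : Ad 1 ξ = ξ := by
  apply Subtype.ext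
  simp [Ad]

theorem isHyperbolic_Ad (g : SL(2, ℝ)) (ξ : sl2) :
    (Ad g ξ).1.IsHyperbolic ↔ ξ.1.IsHyperbolic := by
  have := Matrix.isHyperbolic_conj_iff (m := ξ.1) (g := (g : GL (Fin 2) ℝ))
  rw [← this]
  have h : (Ad g ξ).1 = (g : GL (Fin 2) ℝ).val * ξ.1 * ((g : GL (Fin 2) ℝ)⁻¹).val := by
    rw [← map_inv]; rfl
  rw [h, Matrix.coe_units_inv]

theorem isElliptic_Ad (g : SL(2, ℝ)) (ξ : sl2) :
    (Ad g ξ).1.IsElliptic ↔ ξ.1.IsElliptic := by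
  have := Matrix.isElliptic_conj_iff (m := ξ.1) (g := (g : GL (Fin 2) ℝ))
  rw [← this]
  have h : (Ad g ξ).1 = (g : GL (Fin 2) ℝ).val * ξ.1 * ((g : GL (Fin 2) ℝ)⁻¹).val := by
    rw [← map_inv]; rfl
  rw [h, Matrix.coe_units_inv]

/-! ### The Hamiltonian vector field -/

/-- A covector at `x` that is equivariant under the diagonal action; up to a real factor it is the
differential of the distance to `y`, rotated by a right angle. -/
def dir (x y : ℍ) : ℂ :=
  ((x : ℂ) - y) * ((x : ℂ) - (starRingEnd ℂ) (y : ℂ)) / (((x.im : ℝ) : ℂ) ^ 2 * ((y.im : ℝ) : ℂ))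

/-- The differential at `x` of `cosh (dist x y)`. -/
def gradCosh (x y : ℍ) : ℂ := -(Complex.I / 2) * dir x y

theorem gradCosh_eq (x y : ℍ) : gradCosh x y =
    ⟨(x.re - y.re) / (x.im * y.im),
      (x.im - y.im) / (x.im * y.im) -
        ((x.re - y.re) ^ 2 + (x.im - y.im) ^ 2) / (2 * x.im ^ 2 * y.im)⟩ := by
  have hx := x.im_pos.ne'
  have hy := y.im_pos.ne'
  have hw : ∀ w : ℍ, (w : ℂ) = (w.re : ℂ) + (w.im : ℂ) * Complex.I :=
    fun w => (Complex.re_add_im (w : ℂ)).symm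
  have hxc : (x.im : ℂ) ≠ 0 := by exact_mod_cast hx
  have hyc : (y.im : ℂ) ≠ 0 := by exact_mod_cast hy
  rw [Complex.mk_eq_add_mul_I, gradCosh, dir, hw x, hw y]
  simp only [map_add, map_mul, Complex.conj_ofReal, Complex.conj_I]
  push_cast
  field_simp
  ring_nf
  simp only [Complex.I_sq, Complex.I_pow_three]
  ring

theorem hasDerivAt_cosh_dist {x₁ y₁ x₂ y₂ : ℝ → ℝ} {a₁ b₁ a₂ b₂ t : ℝ}
    (hx₁ : HasDerivAt x₁ a₁ t) (hy₁ : HasDerivAt y₁ b₁ t) (hx₂ : HasDerivAt x₂ a₂ t)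
    (hy₂ : HasDerivAt y₂ b₂ t) {p q : ℍ} (hp : p.re = x₁ t) (hp' : p.im = y₁ t)
    (hq : q.re = x₂ t) (hq' : q.im = y₂ t) :
    HasDerivAt (fun s => 1 + ((x₁ s - x₂ s) ^ 2 + (y₁ s - y₂ s) ^ 2) / (2 * y₁ s * y₂ s))
      (pair (gradCosh p q) ⟨a₁, b₁⟩ + pair (gradCosh q p) ⟨a₂, b₂⟩) t := by
  have h1 : y₁ t ≠ 0 := hp' ▸ p.im_pos.ne'
  have h2 : y₂ t ≠ 0 := hq' ▸ q.im_pos.ne'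
  have h := ((((hx₁.sub hx₂).pow 2).add ((hy₁.sub hy₂).pow 2)).div
    ((hy₁.const_mul 2).mul hy₂) (mul_ne_zero (mul_ne_zero two_ne_zero h1) h2)).const_add 1
  refine h.congr_deriv ?_
  simp only [gradCosh_eq, pair, hp, hp', hq, hq', Pi.add_apply, Pi.sub_apply, Pi.pow_apply,
    Pi.mul_apply]
  field_simp
  ring

/-- Writing `coth` through `C = cosh d` avoids differentiating the distance itself, and produces the
factor `sinh⁻³` in the force. -/
theorem hasDerivAt_coth {C : ℝ → ℝ} {C' t : ℝ} (h : HasDerivAt C C' t) (hC : 1 < C t) :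
    HasDerivAt (fun s => C s / Real.sqrt (C s ^ 2 - 1))
      (-C' / Real.sqrt (C t ^ 2 - 1) ^ 3) t := by
  have hpos : 0 < C t ^ 2 - 1 := by nlinarith
  have hs := Real.sqrt_pos.mpr hpos
  have h1 := h.div (((h.pow 2).sub_const 1).sqrt hpos.ne') hs.ne'
  refine h1.congr_deriv ?_
  have hsq := Real.sq_sqrt hpos.le
  simp only [Pi.pow_apply]
  field_simp
  rw [hsq]
  ring

/-! ### The Hamiltonian in real coordinates and its differential. -/

theorem cosh_dist_coords (x y : ℍ) : Real.cosh (dist x y) =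
    1 + ((x.re - y.re) ^ 2 + (x.im - y.im) ^ 2) / (2 * x.im * y.im) := by
  rw [cosh_dist, Complex.dist_eq, Complex.sq_norm, Complex.normSq_apply]
  congr 2
  simp
  ring

theorem sinh_dist_eq_sqrt (x y : ℍ) :
    Real.sinh (dist x y) = Real.sqrt (Real.cosh (dist x y) ^ 2 - 1) := by
  rw [Real.cosh_sq, add_sub_cancel_right, Real.sqrt_sq (Real.sinh_nonneg_iff.mpr dist_nonneg)]

/-- The Hamiltonian as an explicit function of the coordinates. -/
def hamCoords (k m₁ m₂ : ℝ) (w : (ℂ × ℂ) × (ℂ × ℂ)) : ℝ :=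
  (1 / 2) * (w.1.1.im ^ 2 * (w.2.1.re ^ 2 + w.2.1.im ^ 2) / m₁ +
    w.1.2.im ^ 2 * (w.2.2.re ^ 2 + w.2.2.im ^ 2) / m₂) +
  -k * m₁ * m₂ *
    ((1 + ((w.1.1.re - w.1.2.re) ^ 2 + (w.1.1.im - w.1.2.im) ^ 2) / (2 * w.1.1.im * w.1.2.im)) /
    Real.sqrt ((1 + ((w.1.1.re - w.1.2.re) ^ 2 + (w.1.1.im - w.1.2.im) ^ 2) /
      (2 * w.1.1.im * w.1.2.im)) ^ 2 - 1))

/-- Equality is only local because `ofComplex` takes a default value outside the half plane; this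
suffices for derivatives. -/
theorem hamiltonian_eventuallyEq (k m₁ m₂ : ℝ) (z : Phase) :
    hamiltonian k m₁ m₂ =ᶠ[nhds z.coords] hamCoords k m₁ m₂ := by
  have h1 : ∀ᶠ w : (ℂ × ℂ) × (ℂ × ℂ) in nhds z.coords, 0 < w.1.1.im :=
    (isOpen_lt continuous_const (by fun_prop)).mem_nhds z.q.pos₁.im_pos
  have h2 : ∀ᶠ w : (ℂ × ℂ) × (ℂ × ℂ) in nhds z.coords, 0 < w.1.2.im :=
    (isOpen_lt continuous_const (by fun_prop)).mem_nhds z.q.pos₂.im_pos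
  filter_upwards [h1, h2] with w hw1 hw2
  rw [hamiltonian, hamCoords, potential, sinh_dist_eq_sqrt, cosh_dist_coords,
    ofComplex_apply_of_im_pos hw1, ofComplex_apply_of_im_pos hw2,
    Complex.normSq_apply, Complex.normSq_apply, ← pow_two, ← pow_two, ← pow_two, ← pow_two]
  rfl

theorem dist_pos_config (q : Config) : 0 < dist q.pos₁ q.pos₂ := dist_pos.mpr q.2

theorem sinh_dist_pos (q : Config) : 0 < Real.sinh (dist q.pos₁ q.pos₂) :=
  Real.sinh_pos_iff.mpr (dist_pos_config q)

theorem one_lt_cosh_coords (q : Config) :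
    1 < 1 + ((q.pos₁.re - q.pos₂.re) ^ 2 + (q.pos₁.im - q.pos₂.im) ^ 2) /
      (2 * q.pos₁.im * q.pos₂.im) := by
  rw [← cosh_dist_coords]
  exact Real.one_lt_cosh.mpr (dist_pos_config q).ne'

theorem differentiableAt_hamCoords (k m₁ m₂ : ℝ) (z : Phase) :
    DifferentiableAt ℝ (hamCoords k m₁ m₂) z.coords := by
  have c1 : DifferentiableAt ℝ (fun w : (ℂ × ℂ) × (ℂ × ℂ) => w.1.1.re) z.coords :=
    (Complex.reCLM.comp ((ContinuousLinearMap.fst ℝ ℂ ℂ).comp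
      (ContinuousLinearMap.fst ℝ (ℂ × ℂ) (ℂ × ℂ)))).differentiableAt
  have c2 : DifferentiableAt ℝ (fun w : (ℂ × ℂ) × (ℂ × ℂ) => w.1.1.im) z.coords :=
    (Complex.imCLM.comp ((ContinuousLinearMap.fst ℝ ℂ ℂ).comp
      (ContinuousLinearMap.fst ℝ (ℂ × ℂ) (ℂ × ℂ)))).differentiableAt
  have c3 : DifferentiableAt ℝ (fun w : (ℂ × ℂ) × (ℂ × ℂ) => w.1.2.re) z.coords :=
    (Complex.reCLM.comp ((ContinuousLinearMap.snd ℝ ℂ ℂ).comp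
      (ContinuousLinearMap.fst ℝ (ℂ × ℂ) (ℂ × ℂ)))).differentiableAt
  have c4 : DifferentiableAt ℝ (fun w : (ℂ × ℂ) × (ℂ × ℂ) => w.1.2.im) z.coords :=
    (Complex.imCLM.comp ((ContinuousLinearMap.snd ℝ ℂ ℂ).comp
      (ContinuousLinearMap.fst ℝ (ℂ × ℂ) (ℂ × ℂ)))).differentiableAt
  have c5 : DifferentiableAt ℝ (fun w : (ℂ × ℂ) × (ℂ × ℂ) => w.2.1.re) z.coords :=
    (Complex.reCLM.comp ((ContinuousLinearMap.fst ℝ ℂ ℂ).comp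
      (ContinuousLinearMap.snd ℝ (ℂ × ℂ) (ℂ × ℂ)))).differentiableAt
  have c6 : DifferentiableAt ℝ (fun w : (ℂ × ℂ) × (ℂ × ℂ) => w.2.1.im) z.coords :=
    (Complex.imCLM.comp ((ContinuousLinearMap.fst ℝ ℂ ℂ).comp
      (ContinuousLinearMap.snd ℝ (ℂ × ℂ) (ℂ × ℂ)))).differentiableAt
  have c7 : DifferentiableAt ℝ (fun w : (ℂ × ℂ) × (ℂ × ℂ) => w.2.2.re) z.coords :=
    (Complex.reCLM.comp ((ContinuousLinearMap.snd ℝ ℂ ℂ).comp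
      (ContinuousLinearMap.snd ℝ (ℂ × ℂ) (ℂ × ℂ)))).differentiableAt
  have c8 : DifferentiableAt ℝ (fun w : (ℂ × ℂ) × (ℂ × ℂ) => w.2.2.im) z.coords :=
    (Complex.imCLM.comp ((ContinuousLinearMap.snd ℝ ℂ ℂ).comp
      (ContinuousLinearMap.snd ℝ (ℂ × ℂ) (ℂ × ℂ)))).differentiableAt
  have hC : DifferentiableAt ℝ (fun w : (ℂ × ℂ) × (ℂ × ℂ) =>
      1 + ((w.1.1.re - w.1.2.re) ^ 2 + (w.1.1.im - w.1.2.im) ^ 2) / (2 * w.1.1.im * w.1.2.im))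
      z.coords := by
    have hne : 2 * z.coords.1.1.im * z.coords.1.2.im ≠ 0 :=
      mul_ne_zero (mul_ne_zero two_ne_zero z.q.pos₁.im_pos.ne') z.q.pos₂.im_pos.ne'
    simp only [div_eq_mul_inv]
    exact ((((c1.fun_sub c3).fun_pow 2).fun_add ((c2.fun_sub c4).fun_pow 2)).fun_mul
      (((c2.const_mul 2).fun_mul c4).fun_inv hne)).const_add 1
  have h1 := one_lt_cosh_coords z.q
  have hpos : 0 < (1 + ((z.q.pos₁.re - z.q.pos₂.re) ^ 2 + (z.q.pos₁.im - z.q.pos₂.im) ^ 2) /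
      (2 * z.q.pos₁.im * z.q.pos₂.im)) ^ 2 - 1 := by nlinarith
  have hS := ((hC.fun_pow 2).sub_const 1).sqrt hpos.ne'
  have hSi := hS.fun_inv (Real.sqrt_pos.mpr hpos).ne'
  have hK1 := ((c2.fun_pow 2).fun_mul ((c5.fun_pow 2).fun_add (c6.fun_pow 2))).mul_const m₁⁻¹
  have hK2 := ((c4.fun_pow 2).fun_mul ((c7.fun_pow 2).fun_add (c8.fun_pow 2))).mul_const m₂⁻¹
  have h := ((hK1.fun_add hK2).const_mul (1 / 2)).fun_add ((hC.fun_mul hSi).const_mul (-k * m₁ * m₂))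
  exact h.congr_of_eventuallyEq (Filter.Eventually.of_forall fun w => by
    simp only [hamCoords, div_eq_mul_inv])

/-- The velocity part and the force part of the Hamiltonian vector field. -/
def hamField (k m₁ m₂ : ℝ) (z : Phase) : (ℂ × ℂ) × (ℂ × ℂ) :=
  ((((z.q.pos₁.im ^ 2 / m₁ : ℝ) : ℂ) * z.p₁, ((z.q.pos₂.im ^ 2 / m₂ : ℝ) : ℂ) * z.p₂),
    (-((z.q.pos₁.im * Complex.normSq z.p₁ / m₁ : ℝ) : ℂ) * Complex.I -
        ((k * m₁ * m₂ / Real.sinh (dist z.q.pos₁ z.q.pos₂) ^ 3 : ℝ) : ℂ) *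
          gradCosh z.q.pos₁ z.q.pos₂,
      -((z.q.pos₂.im * Complex.normSq z.p₂ / m₂ : ℝ) : ℂ) * Complex.I -
        ((k * m₁ * m₂ / Real.sinh (dist z.q.pos₁ z.q.pos₂) ^ 3 : ℝ) : ℂ) *
          gradCosh z.q.pos₂ z.q.pos₁))

theorem fderiv_hamiltonian (k m₁ m₂ : ℝ) (z : Phase) (v : (ℂ × ℂ) × (ℂ × ℂ)) :
    fderiv ℝ (hamiltonian k m₁ m₂) z.coords v = sympForm (hamField k m₁ m₂ z) v := by
  rw [(hamiltonian_eventuallyEq k m₁ m₂ z).fderiv_eq,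
    -- Differentiability known, the differential can be computed along the line through the phase
    -- point in the direction `v`.
    ← (differentiableAt_hamCoords k m₁ m₂ z).lineDeriv_eq_fderiv]
  apply HasLineDerivAt.lineDeriv
  rw [HasLineDerivAt]
  have aff : ∀ a b : ℝ, HasDerivAt (fun s : ℝ => a + s * b) b 0 := by
    intro a b
    simpa using! ((hasDerivAt_id (0 : ℝ)).mul_const b).const_add a
  have c1 := aff z.q.pos₁.re v.1.1.re
  have c2 := aff z.q.pos₁.im v.1.1.im
  have c3 := aff z.q.pos₂.re v.1.2.re
  have c4 := aff z.q.pos₂.im v.1.2.im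
  have c5 := aff z.p₁.re v.2.1.re
  have c6 := aff z.p₁.im v.2.1.im
  have c7 := aff z.p₂.re v.2.2.re
  have c8 := aff z.p₂.im v.2.2.im
  have hC := hasDerivAt_cosh_dist c1 c2 c3 c4 (p := z.q.pos₁) (q := z.q.pos₂)
    (by simp) (by simp) (by simp) (by simp)
  have hV := (hasDerivAt_coth hC (by simpa using one_lt_cosh_coords z.q)).const_mul (-k * m₁ * m₂)
  have hK1 := ((c2.fun_pow 2).fun_mul ((c5.fun_pow 2).fun_add (c6.fun_pow 2))).div_const m₁
  have hK2 := ((c4.fun_pow 2).fun_mul ((c7.fun_pow 2).fun_add (c8.fun_pow 2))).div_const m₂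
  have hH := ((hK1.fun_add hK2).const_mul (1 / 2)).fun_add hV
  refine (hH.congr_of_eventuallyEq (Filter.Eventually.of_forall fun s => ?_)).congr_deriv ?_
  · simp [hamCoords, Phase.coords]
  · simp only [zero_mul, add_zero]
    rw [← cosh_dist_coords, ← sinh_dist_eq_sqrt]
    simp only [sympForm, hamField, pair, Complex.normSq_apply, Complex.sub_re, Complex.sub_im,
      neg_mul, Complex.neg_re, Complex.neg_im, Complex.re_ofReal_mul, Complex.im_ofReal_mul,
      Complex.I_re, Complex.I_im]
    norm_num
    ring

theorem sympForm_ext {X Y : (ℂ × ℂ) × (ℂ × ℂ)} (h : ∀ v, sympForm X v = sympForm Y v) : X = Y := by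
  have h1 := h ((0, 0), (1, 0))
  have h2 := h ((0, 0), (Complex.I, 0))
  have h3 := h ((0, 0), (0, 1))
  have h4 := h ((0, 0), (0, Complex.I))
  have h5 := h ((1, 0), (0, 0))
  have h6 := h ((Complex.I, 0), (0, 0))
  have h7 := h ((0, 1), (0, 0))
  have h8 := h ((0, Complex.I), (0, 0))
  simp [sympForm, pair] at h1 h2 h3 h4 h5 h6 h7 h8
  exact Prod.ext (Prod.ext (Complex.ext h1 h2) (Complex.ext h3 h4))
    (Prod.ext (Complex.ext h5 h6) (Complex.ext h7 h8))

theorem isSolution_iff (k m₁ m₂ : ℝ) (z : ℝ → Phase) : IsSolution k m₁ m₂ z ↔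
    ∀ t, HasDerivAt (fun s => (z s).coords) (hamField k m₁ m₂ (z t)) t := by
  refine forall_congr' fun t => ⟨?_, fun h => ⟨_, h, fun v => (fderiv_hamiltonian ..).symm⟩⟩
  rintro ⟨X, hX, h⟩
  rwa [← sympForm_ext fun v => (h v).trans (fderiv_hamiltonian k m₁ m₂ (z t) v)]

/-! ### Relative equilibria as solutions of algebraic equations -/

theorem pos₁_smul (g : SL(2, ℝ)) (q : Config) : (g • q).pos₁ = g • q.pos₁ := rfl

theorem pos₂_smul (g : SL(2, ℝ)) (q : Config) : (g • q).pos₂ = g • q.pos₂ := rfl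

theorem im_ne_zero' (x : ℍ) : ((x.im : ℝ) : ℂ) ≠ 0 := Complex.ofReal_ne_zero.mpr x.im_pos.ne'

theorem liftCovector_metric (m : ℝ) (g : SL(2, ℝ)) (ξ : sl2) (x : ℍ) :
    liftCovector g x (((m / x.im ^ 2 : ℝ) : ℂ) * quad ξ x) =
      ((m / (g • x).im ^ 2 : ℝ) : ℂ) * quad (Ad g ξ) ((g • x : ℍ) : ℂ) := by
  have hd := den_ne_zero g x
  have hd' := conj_den_ne_zero g x
  have hx := im_ne_zero' x
  rw [quad_Ad, liftCovector_eq]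
  push_cast
  rw [im_smul_den]
  field_simp

/-- The kinetic metric is invariant, so the Legendre transform intertwines the two actions. -/
theorem smul_momentumOf (m₁ m₂ : ℝ) (g : SL(2, ℝ)) (q : Config) (ξ : sl2) :
    g • momentumOf m₁ m₂ q ξ = momentumOf m₁ m₂ (g • q) (Ad g ξ) := by
  refine Phase.ext rfl ?_ ?_
  · change liftCovector g q.pos₁ (_ * generator ξ q.pos₁) = _ * generator (Ad g ξ) (g • q.pos₁)
    rw [generator_eq, generator_eq]
    exact liftCovector_metric m₁ g ξ q.pos₁
  · change liftCovector g q.pos₂ (_ * generator ξ q.pos₂) = _ * generator (Ad g ξ) (g • q.pos₂)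
    rw [generator_eq, generator_eq]
    exact liftCovector_metric m₂ g ξ q.pos₂

theorem motion_eq (m₁ m₂ : ℝ) (q : Config) (ξ : sl2) (t : ℝ) :
    motion m₁ m₂ q ξ t = momentumOf m₁ m₂ (expSL (t • ξ) • q) ξ := by
  rw [motion, smul_momentumOf, Ad_expSL_self]

/-- The equation of motion at the point `x` in the field of the point `y` of mass `m`. -/
def BalanceAt (k m : ℝ) (x y : ℍ) (ξ : sl2) : Prop :=
  quad ξ x * ((polar ξ x : ℝ) : ℂ) / ((x.im : ℝ) : ℂ) =
    ((k * m / (2 * Real.sinh (dist x y) ^ 3) : ℝ) : ℂ) *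
      (((x : ℂ) - y) * ((x : ℂ) - (starRingEnd ℂ) (y : ℂ)) / ((y.im : ℝ) : ℂ))

/-- The algebraic equations characterizing relative equilibria. -/
def Balance (k m₁ m₂ : ℝ) (q : Config) (ξ : sl2) : Prop :=
  BalanceAt k m₂ q.pos₁ q.pos₂ ξ ∧ BalanceAt k m₁ q.pos₂ q.pos₁ ξ

theorem balanceAt_smul (k m : ℝ) (g : SL(2, ℝ)) (x y : ℍ) (ξ : sl2) :
    BalanceAt k m (g • x) (g • y) (Ad g ξ) ↔ BalanceAt k m x y ξ := by
  have hd := den_ne_zero g x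
  have hd' := conj_den_ne_zero g x
  have he := den_ne_zero g y
  have he' := conj_den_ne_zero g y
  have hx := im_ne_zero' x
  have hy := im_ne_zero' y
  rw [BalanceAt, BalanceAt, quad_Ad, polar_Ad, im_smul_den, im_smul_den, coe_smul_sub_coe_smul,
    coe_smul_sub_conj_smul, dist_smul]
  -- Both sides transform as tangent vectors at `x`; multiplying by the square of the automorphy
  -- factor of `x` undoes this.
  rw [← mul_left_inj' (pow_ne_zero 2 hd)]
  refine Eq.congr ?_ ?_ <;> field_simp

theorem balance_smul (k m₁ m₂ : ℝ) (g : SL(2, ℝ)) (q : Config) (ξ : sl2) :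
    Balance k m₁ m₂ (g • q) (Ad g ξ) ↔ Balance k m₁ m₂ q ξ :=
  and_congr (balanceAt_smul ..) (balanceAt_smul ..)

/-- The derivative is split so that its first summand is the kinetic part of the force in
`hamField`. The second is the covariant acceleration, expressed as a covector. -/
theorem hasDerivAt_momentum {m t : ℝ} {ξ : sl2} {z : ℝ → ℂ}
    (hz : HasDerivAt z (quad ξ (z t)) t) (him : (z t).im ≠ 0) :
    HasDerivAt (fun s => ((m / (z s).im ^ 2 : ℝ) : ℂ) * quad ξ (z s))
      (-(((z t).im * (m * (Complex.normSq (quad ξ (z t)) / (z t).im ^ 4)) : ℝ) : ℂ) * Complex.I +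
        Complex.I * ((m / (z t).im ^ 3 : ℝ) : ℂ) * quad ξ (z t) * ((polar ξ (z t) : ℝ) : ℂ)) t := by
  have hy : HasDerivAt (fun s => (z s).im) (quad ξ (z t)).im t :=
    Complex.imCLM.hasFDerivAt.comp_hasDerivAt t hz
  have hm : HasDerivAt (fun s => m / (z s).im ^ 2) (-2 * m * (quad ξ (z t)).im / (z t).im ^ 3) t := by
    refine ((hasDerivAt_const t m).fun_div (hy.fun_pow 2) (pow_ne_zero 2 him)).congr_deriv ?_
    field_simp
    ring
  have hq : HasDerivAt (fun s => quad ξ (z s))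
      ((2 * ((ξ.1 0 0 : ℝ) : ℂ) - 2 * ((ξ.1 1 0 : ℝ) : ℂ) * z t) * quad ξ (z t)) t := by
    refine (((hz.const_mul (2 * ((ξ.1 0 0 : ℝ) : ℂ))).const_add ((ξ.1 0 1 : ℝ) : ℂ)).fun_sub
      ((hz.fun_pow 2).const_mul ((ξ.1 1 0 : ℝ) : ℂ))).congr_deriv ?_
    push_cast
    ring
  refine (hm.ofReal_comp.fun_mul hq).congr_deriv ?_
  have hyc : (((z t).im : ℝ) : ℂ) ≠ 0 := Complex.ofReal_ne_zero.mpr him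
  have hn : ((Complex.normSq (quad ξ (z t)) : ℝ) : ℂ) =
      quad ξ (z t) * (starRingEnd ℂ) (quad ξ (z t)) := (Complex.mul_conj _).symm
  have hG : (((quad ξ (z t)).im : ℝ) : ℂ) =
      -Complex.I / 2 * (quad ξ (z t) - (starRingEnd ℂ) (quad ξ (z t))) := by
    rw [Complex.sub_conj]
    push_cast
    ring_nf
    rw [Complex.I_sq]
    ring
  have hY : (((z t).im : ℝ) : ℂ) = -Complex.I / 2 * (z t - (starRingEnd ℂ) (z t)) := by
    rw [Complex.sub_conj]
    push_cast
    ring_nf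
    rw [Complex.I_sq]
    ring
  -- With `G = quad` and `N = polar` this reads `-2 Im G + y G' = -i conj G + i N`; the term with
  -- `conj G` yields `|G|²`.
  have key : -2 * (((quad ξ (z t)).im : ℝ) : ℂ) +
      (((z t).im : ℝ) : ℂ) * (2 * ((ξ.1 0 0 : ℝ) : ℂ) - 2 * ((ξ.1 1 0 : ℝ) : ℂ) * z t) =
      -Complex.I * (starRingEnd ℂ) (quad ξ (z t)) + Complex.I * ((polar ξ (z t) : ℝ) : ℂ) := by
    rw [hG, hY, polar_eq]
    simp only [quad]
    ring
  push_cast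
  rw [hn]
  field_simp
  linear_combination (((m : ℝ) : ℂ) * quad ξ (z t)) * key

theorem hasDerivAt_coords {z : ℝ → Phase} {t : ℝ} {X : (ℂ × ℂ) × (ℂ × ℂ)} :
    HasDerivAt (fun s => (z s).coords) X t ↔
      (HasDerivAt (fun s => ((z s).q.pos₁ : ℂ)) X.1.1 t ∧
        HasDerivAt (fun s => ((z s).q.pos₂ : ℂ)) X.1.2 t) ∧
      HasDerivAt (fun s => (z s).p₁) X.2.1 t ∧ HasDerivAt (fun s => (z s).p₂) X.2.2 t := by
  constructor
  · intro h
    refine ⟨⟨?_, ?_⟩, ?_, ?_⟩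
    · exact h.fst.fst
    · exact h.fst.snd
    · exact h.snd.fst
    · exact h.snd.snd
  · rintro ⟨⟨h₁, h₂⟩, h₃, h₄⟩
    exact (h₁.prodMk h₂).prodMk (h₃.prodMk h₄)

theorem force_eq_iff {k m M S : ℝ} (hm : 0 < m) (hS : 0 < S) (x y : ℍ) (ξ : sl2)
    (hd : Real.sinh (dist x y) = S) :
    Complex.I * ((m / x.im ^ 3 : ℝ) : ℂ) * quad ξ x * ((polar ξ x : ℝ) : ℂ) =
        -(((k * m * M / S ^ 3 : ℝ) : ℂ) * gradCosh x y) ↔ BalanceAt k M x y ξ := by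
  have hx := im_ne_zero' x
  have hy := im_ne_zero' y
  have hmc : (m : ℂ) ≠ 0 := Complex.ofReal_ne_zero.mpr hm.ne'
  have hSc : (S : ℂ) ≠ 0 := Complex.ofReal_ne_zero.mpr hS.ne'
  have hc : Complex.I * ((m / x.im ^ 2 : ℝ) : ℂ) ≠ 0 := by
    push_cast
    exact mul_ne_zero Complex.I_ne_zero (div_ne_zero hmc (pow_ne_zero 2 hx))
  rw [BalanceAt, hd, gradCosh, dir]
  conv_rhs => rw [← mul_right_inj' hc]
  refine Eq.congr ?_ ?_
  · push_cast
    field_simp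
  · push_cast
    field_simp

theorem normSq_metric (m y : ℝ) (G : ℂ) (hm : 0 < m) (hy : 0 < y) :
    y * Complex.normSq (((m / y ^ 2 : ℝ) : ℂ) * G) / m = y * (m * (Complex.normSq G / y ^ 4)) := by
  rw [Complex.normSq_mul, Complex.normSq_ofReal]
  field_simp

theorem isRelEqPair_iff {k m₁ m₂ : ℝ} (hm₁ : 0 < m₁) (hm₂ : 0 < m₂) (q : Config) (ξ : sl2) :
    IsRelEqPair k m₁ m₂ q ξ ↔ Balance k m₁ m₂ q ξ := by
  have hinv : ∀ t : ℝ, Balance k m₁ m₂ (expSL (t • ξ) • q) ξ ↔ Balance k m₁ m₂ q ξ := by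
    intro t
    have h := balance_smul k m₁ m₂ (expSL (t • ξ)) q ξ
    rwa [Ad_expSL_self] at h
  rw [IsRelEqPair, isSolution_iff]
  -- By `hinv` the condition at each time is the same condition at time zero.
  refine Iff.trans (forall_congr' fun t => ?_) (forall_const ℝ)
  rw [← hinv t, hasDerivAt_coords]
  have hz₁ := hasDerivAt_expSL_smul ξ q.pos₁ t
  have hz₂ := hasDerivAt_expSL_smul ξ q.pos₂ t
  have hp₁ := hasDerivAt_momentum (m := m₁) hz₁ (im_pos (expSL (t • ξ) • q.pos₁)).ne'
  have hp₂ := hasDerivAt_momentum (m := m₂) hz₂ (im_pos (expSL (t • ξ) • q.pos₂)).ne'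
  simp only [motion_eq]
  set r := expSL (t • ξ) • q with hr
  have hy₁ := r.pos₁.im_pos
  have hy₂ := r.pos₂.im_pos
  have hv : ∀ (m : ℝ) (x : ℍ), 0 < m →
      quad ξ x = ((x.im ^ 2 / m : ℝ) : ℂ) * (((m / x.im ^ 2 : ℝ) : ℂ) * quad ξ x) := by
    intro m x hm
    have hx := im_ne_zero' x
    have hmc : (m : ℂ) ≠ 0 := Complex.ofReal_ne_zero.mpr hm.ne'
    push_cast
    field_simp
  have hq₁ : HasDerivAt (fun s => ((momentumOf m₁ m₂ (expSL (s • ξ) • q) ξ).q.pos₁ : ℂ))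
      (hamField k m₁ m₂ (momentumOf m₁ m₂ r ξ)).1.1 t := by
    refine hz₁.congr_deriv ?_
    simp only [hamField, momentumOf, generator_eq]
    exact hv m₁ r.pos₁ hm₁
  have hq₂ : HasDerivAt (fun s => ((momentumOf m₁ m₂ (expSL (s • ξ) • q) ξ).q.pos₂ : ℂ))
      (hamField k m₁ m₂ (momentumOf m₁ m₂ r ξ)).1.2 t := by
    refine hz₂.congr_deriv ?_
    simp only [hamField, momentumOf, generator_eq]
    exact hv m₂ r.pos₂ hm₂
  have hS := sinh_dist_pos r
  rw [and_iff_right ⟨hq₁, hq₂⟩, Balance, ← force_eq_iff hm₁ hS r.pos₁ r.pos₂ ξ rfl,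
    ← force_eq_iff hm₂ hS r.pos₂ r.pos₁ ξ (by rw [dist_comm])]
  have hp₁' : HasDerivAt (fun s => (momentumOf m₁ m₂ (expSL (s • ξ) • q) ξ).p₁) _ t :=
    hp₁.congr_of_eventuallyEq (Filter.Eventually.of_forall fun s => by
      simp only [momentumOf, generator_eq]; rfl)
  have hp₂' : HasDerivAt (fun s => (momentumOf m₁ m₂ (expSL (s • ξ) • q) ξ).p₂) _ t :=
    hp₂.congr_of_eventuallyEq (Filter.Eventually.of_forall fun s => by
      simp only [momentumOf, generator_eq]; rfl)
  have huniq : ∀ {f : ℝ → ℂ} {a b : ℂ}, HasDerivAt f a t → (HasDerivAt f b t ↔ a = b) :=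
    fun h => ⟨fun h' => h.unique h', fun e => e ▸ h⟩
  rw [huniq hp₁', huniq hp₂']
  simp only [hamField, momentumOf, generator_eq]
  rw [normSq_metric m₁ _ _ hm₁ hy₁, normSq_metric m₂ _ _ hm₂ hy₂, sub_eq_add_neg, sub_eq_add_neg]
  rw [mul_right_comm k m₂ m₁]
  -- The kinetic terms on the two sides cancel, leaving acceleration against potential force.
  exact and_congr (add_right_inj _) (add_right_inj _)

/-! ### Relative equilibria in canonical configurations -/

/-- On the unit circle `conj x = x⁻¹`, so `quad ξ x = x (b conj x + 2a - c x)` and `(x - y)(x - conj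
y) = 2x (Re x - Re y)`. After division by `x` the force is real, and the two equations are the
imaginary and the real part. -/
theorem balanceAt_unit_iff {k m S : ℝ} {x y : ℍ} (hx : x.re ^ 2 + x.im ^ 2 = 1)
    (hy : y.re ^ 2 + y.im ^ 2 = 1) (hd : Real.sinh (dist x y) = S) (ξ : sl2) :
    BalanceAt k m x y ξ ↔
      (ξ.1 0 1 + ξ.1 1 0) * (ξ.1 0 1 - ξ.1 1 0 + 2 * ξ.1 0 0 * x.re) = 0 ∧
      (2 * ξ.1 0 0 + (ξ.1 0 1 - ξ.1 1 0) * x.re) * (ξ.1 0 1 - ξ.1 1 0 + 2 * ξ.1 0 0 * x.re) =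
        x.im * (k * m * (x.re - y.re) / (S ^ 3 * y.im)) := by
  have hxi := x.im_pos.ne'
  have hN : polar ξ x = ξ.1 0 1 - ξ.1 1 0 + 2 * ξ.1 0 0 * x.re := by
    change ξ.1 0 1 + 2 * ξ.1 0 0 * x.re - ξ.1 1 0 * (x.re ^ 2 + x.im ^ 2) = _
    rw [hx]
    ring
  have hw : ∀ w : ℍ, (w : ℂ) = (w.re : ℂ) + (w.im : ℂ) * Complex.I :=
    fun w => (Complex.re_add_im (w : ℂ)).symm
  have hxc : ((x.re : ℝ) : ℂ) ^ 2 + ((x.im : ℝ) : ℂ) ^ 2 = 1 := by exact_mod_cast hx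
  have hyc : ((y.re : ℝ) : ℂ) ^ 2 + ((y.im : ℝ) : ℂ) ^ 2 = 1 := by exact_mod_cast hy
  have h₁ : quad ξ x = x * (((2 * ξ.1 0 0 + (ξ.1 0 1 - ξ.1 1 0) * x.re : ℝ) : ℂ) +
      ((-(ξ.1 0 1 + ξ.1 1 0) * x.im : ℝ) : ℂ) * Complex.I) := by
    rw [hw x, quad]
    push_cast
    linear_combination (-((ξ.1 0 1 : ℝ) : ℂ)) * hxc +
      (((ξ.1 0 1 : ℝ) : ℂ) * ((x.im : ℝ) : ℂ) ^ 2) * Complex.I_sq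
  have h₂ : ((x : ℂ) - y) * ((x : ℂ) - (starRingEnd ℂ) (y : ℂ)) =
      x * ((2 * (x.re - y.re) : ℝ) : ℂ) := by
    rw [hw x, hw y]
    simp only [map_add, map_mul, Complex.conj_ofReal, Complex.conj_I]
    push_cast
    linear_combination hyc - hxc +
      (((x.im : ℝ) : ℂ) ^ 2 - ((y.im : ℝ) : ℂ) ^ 2) * Complex.I_sq
  have h0 : (x : ℂ) ≠ 0 := x.ne_zero
  rw [BalanceAt, h₁, h₂, hN, hd]
  set N := ξ.1 0 1 - ξ.1 1 0 + 2 * ξ.1 0 0 * x.re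
  set A := 2 * ξ.1 0 0 + (ξ.1 0 1 - ξ.1 1 0) * x.re
  have hl : (x : ℂ) * ((A : ℂ) + ((-(ξ.1 0 1 + ξ.1 1 0) * x.im : ℝ) : ℂ) * Complex.I) * (N : ℂ) /
      ((x.im : ℝ) : ℂ) = x * (⟨A * N / x.im, -((ξ.1 0 1 + ξ.1 1 0) * N)⟩ : ℂ) := by
    have := im_ne_zero' x
    rw [Complex.mk_eq_add_mul_I]
    push_cast
    field_simp
  have hr : ((k * m / (2 * S ^ 3) : ℝ) : ℂ) * ((x : ℂ) * ((2 * (x.re - y.re) : ℝ) : ℂ) /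
      ((y.im : ℝ) : ℂ)) = x * (⟨k * m * (x.re - y.re) / (S ^ 3 * y.im), 0⟩ : ℂ) := by
    have := im_ne_zero' y
    rw [Complex.mk_eq_add_mul_I]
    push_cast
    field_simp
    ring
  rw [hl, hr, mul_right_inj' h0, Complex.ext_iff]
  simp only [neg_eq_zero]
  rw [and_comm, div_eq_iff hxi, mul_comm (k * m * (x.re - y.re) / (S ^ 3 * y.im))]

/-- The data of a canonical configuration. -/
theorem IsCanonical.coords {m₁ m₂ θ₁ θ₂ : ℝ} {q : Config} (h : IsCanonical m₁ m₂ θ₁ θ₂ q) :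
    q.pos₁.re = Real.cos θ₁ ∧ q.pos₁.im = Real.sin θ₁ ∧ q.pos₂.re = -Real.cos θ₂ ∧
      q.pos₂.im = Real.sin θ₂ := by
  obtain ⟨-, -, -, -, h₁, h₂, -⟩ := h
  rw [Complex.ext_iff] at h₁ h₂
  exact ⟨h₁.1, h₁.2, h₂.1, h₂.2⟩

theorem IsCanonical.pos {m₁ m₂ θ₁ θ₂ : ℝ} {q : Config} (h : IsCanonical m₁ m₂ θ₁ θ₂ q) :
    0 < Real.cos θ₁ ∧ 0 < Real.sin θ₁ ∧ 0 < Real.cos θ₂ ∧ 0 < Real.sin θ₂ := by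
  obtain ⟨h₁, h₂, h₃, h₄, -⟩ := h
  have := Real.pi_pos
  exact ⟨Real.cos_pos_of_mem_Ioo ⟨by linarith, h₂⟩, Real.sin_pos_of_pos_of_lt_pi h₁ (by linarith),
    Real.cos_pos_of_mem_Ioo ⟨by linarith, h₄⟩, Real.sin_pos_of_pos_of_lt_pi h₃ (by linarith)⟩

theorem IsCanonical.masses {m₁ m₂ θ₁ θ₂ : ℝ} {q : Config} (h : IsCanonical m₁ m₂ θ₁ θ₂ q)
    (hm₂ : 0 < m₂) :
    m₁ * (Real.sin θ₂ ^ 2 * Real.cos θ₁) = m₂ * (Real.cos θ₂ * Real.sin θ₁ ^ 2) := by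
  obtain ⟨p₁, p₂, p₃, p₄⟩ := h.pos
  have h7 := h.2.2.2.2.2.2
  rw [div_eq_div_iff hm₂.ne' (by positivity)] at h7
  linarith

/-- This is the addition formula for distances `s₁`, `s₂` to `i` with `sinh sⱼ = cot θⱼ` and `cosh
sⱼ = 1 / sin θⱼ`, checked here by squaring. -/
theorem IsCanonical.sinh_dist {m₁ m₂ θ₁ θ₂ : ℝ} {q : Config} (h : IsCanonical m₁ m₂ θ₁ θ₂ q) :
    Real.sinh (dist q.pos₁ q.pos₂) =
      (Real.cos θ₁ + Real.cos θ₂) / (Real.sin θ₁ * Real.sin θ₂) := by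
  obtain ⟨p₁, p₂, p₃, p₄⟩ := h.pos
  obtain ⟨e₁, e₂, e₃, e₄⟩ := h.coords
  have hsq : Real.sinh (dist q.pos₁ q.pos₂) ^ 2 =
      ((Real.cos θ₁ + Real.cos θ₂) / (Real.sin θ₁ * Real.sin θ₂)) ^ 2 := by
    rw [Real.sinh_sq, cosh_dist_coords, e₁, e₂, e₃, e₄]
    have t₁ := Real.sin_sq_add_cos_sq θ₁
    have t₂ := Real.sin_sq_add_cos_sq θ₂
    have hC : 1 + ((Real.cos θ₁ - -Real.cos θ₂) ^ 2 + (Real.sin θ₁ - Real.sin θ₂) ^ 2) /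
        (2 * Real.sin θ₁ * Real.sin θ₂) =
        (1 + Real.cos θ₁ * Real.cos θ₂) / (Real.sin θ₁ * Real.sin θ₂) := by
      field_simp
      linear_combination t₁ + t₂
    rw [hC]
    field_simp
    linear_combination (Real.sin θ₂ ^ 2) * (-t₁) - (1 - Real.cos θ₁ ^ 2) * t₂
  exact (sq_eq_sq₀ (sinh_dist_pos q).le (by positivity)).mp hsq

/-- The squared velocity. -/
def omegaSq (k m₁ θ₁ θ₂ : ℝ) : ℝ :=
  k * (Real.sin θ₂ ^ 2 * Real.sin θ₁ ^ 2 / (Real.cos θ₂ + Real.cos θ₁) ^ 2) *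
      (Real.sin θ₂ ^ 2 / Real.cos θ₂ * m₁)

/-- The mass ratio is exactly what makes the two expressions for `ω²` coincide. -/
theorem IsCanonical.omegaCondition_iff {k m₁ m₂ θ₁ θ₂ : ℝ} {q : Config}
    (h : IsCanonical m₁ m₂ θ₁ θ₂ q) (hm₂ : 0 < m₂) (ω : ℝ) :
    OmegaCondition k m₁ m₂ θ₁ θ₂ ω ↔ ω ^ 2 = omegaSq k m₁ θ₁ θ₂ := by
  obtain ⟨p₁, p₂, p₃, p₄⟩ := h.pos
  have e : Real.sin θ₂ ^ 2 / Real.cos θ₂ * m₁ = Real.sin θ₁ ^ 2 / Real.cos θ₁ * m₂ := by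
    field_simp
    linarith [h.masses hm₂]
  rw [OmegaCondition, ← e, and_self_iff, omegaSq]

theorem IsCanonical.omegaSq_pos {k m₁ m₂ θ₁ θ₂ : ℝ} {q : Config}
    (h : IsCanonical m₁ m₂ θ₁ θ₂ q) (hk : 0 < k) (hm₁ : 0 < m₁) : 0 < omegaSq k m₁ θ₁ θ₂ := by
  obtain ⟨p₁, p₂, p₃, p₄⟩ := h.pos
  unfold omegaSq
  positivity

theorem balance_algebra {a b c x₁ x₂ W : ℝ} (hx₁ : 0 < x₁) (hx₂ : 0 < x₂) (hW : 0 < W) :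
    (((b + c) * (b - c + 2 * a * x₁) = 0 ∧
        (2 * a + (b - c) * x₁) * (b - c + 2 * a * x₁) = x₁ * W) ∧
      ((b + c) * (b - c + 2 * a * -x₂) = 0 ∧
        (2 * a + (b - c) * -x₂) * (b - c + 2 * a * -x₂) = -(x₂ * W))) ↔
    c = -b ∧ ((b = 0 ∧ (2 * a) ^ 2 = W) ∨ (a = 0 ∧ (2 * b) ^ 2 = W)) := by
  constructor
  · rintro ⟨⟨h₁, h₂⟩, -, h₄⟩
    -- This factor is `polar` at the first mass: were it zero, nothing would balance the nonzero
    -- force.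
    have hN : b - c + 2 * a * x₁ ≠ 0 := by
      intro h0
      rw [h0, mul_zero] at h₂
      exact (mul_pos hx₁ hW).ne h₂
    have hc : c = -b := by
      have := (mul_eq_zero.mp h₁).resolve_right hN
      linarith
    subst hc
    -- Weighting the two real equations by `x₂` and `x₁` eliminates both `W` and `a² + b²`.
    have hab : a * b * ((x₁ + x₂) * (1 + x₁ * x₂)) = 0 := by
      linear_combination (1 / 4) * x₂ * h₂ + (1 / 4) * x₁ * h₄
    have hab' := (mul_eq_zero.mp hab).resolve_right (by positivity)
    refine ⟨rfl, ?_⟩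
    rcases mul_eq_zero.mp hab' with h | h
    · right
      subst h
      refine ⟨rfl, mul_left_cancel₀ hx₁.ne' ?_⟩
      linear_combination h₂
    · left
      subst h
      refine ⟨rfl, mul_left_cancel₀ hx₁.ne' ?_⟩
      linear_combination h₂
  · rintro ⟨rfl, ⟨rfl, h⟩ | ⟨rfl, h⟩⟩
    · refine ⟨⟨by ring, ?_⟩, by ring, ?_⟩
      · rw [← h]; ring
      · rw [← h]; ring
    · refine ⟨⟨by ring, ?_⟩, by ring, ?_⟩
      · rw [← h]; ring
      · rw [← h]; ring

theorem IsCanonical.balance_iff {k m₁ m₂ θ₁ θ₂ : ℝ} {q : Config}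
    (h : IsCanonical m₁ m₂ θ₁ θ₂ q) (hk : 0 < k) (hm₁ : 0 < m₁) (hm₂ : 0 < m₂) (ξ : sl2) :
    Balance k m₁ m₂ q ξ ↔ ξ.1 1 0 = -ξ.1 0 1 ∧
      ((ξ.1 0 1 = 0 ∧ (2 * ξ.1 0 0) ^ 2 = omegaSq k m₁ θ₁ θ₂) ∨
        (ξ.1 0 0 = 0 ∧ (2 * ξ.1 0 1) ^ 2 = omegaSq k m₁ θ₁ θ₂)) := by
  obtain ⟨p₁, p₂, p₃, p₄⟩ := h.pos
  obtain ⟨e₁, e₂, e₃, e₄⟩ := h.coords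
  have u₁ : q.pos₁.re ^ 2 + q.pos₁.im ^ 2 = 1 := by
    rw [e₁, e₂, Real.cos_sq_add_sin_sq]
  have u₂ : q.pos₂.re ^ 2 + q.pos₂.im ^ 2 = 1 := by
    rw [e₃, e₄, neg_sq, Real.cos_sq_add_sin_sq]
  rw [← balance_algebra p₁ p₃ (h.omegaSq_pos hk hm₁), Balance,
    balanceAt_unit_iff u₁ u₂ h.sinh_dist, balanceAt_unit_iff u₂ u₁ (by rw [dist_comm, h.sinh_dist]),
    e₁, e₂, e₃, e₄]
  have k₁ : Real.sin θ₁ * (k * m₂ * (Real.cos θ₁ - -Real.cos θ₂) /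
      (((Real.cos θ₁ + Real.cos θ₂) / (Real.sin θ₁ * Real.sin θ₂)) ^ 3 * Real.sin θ₂)) =
      Real.cos θ₁ * omegaSq k m₁ θ₁ θ₂ := by
    have hm := h.masses hm₂
    rw [omegaSq, sub_neg_eq_add, add_comm (Real.cos θ₂)]
    field_simp
    linear_combination -hm
  have k₂ : Real.sin θ₂ * (k * m₁ * (-Real.cos θ₂ - Real.cos θ₁) /
      (((Real.cos θ₁ + Real.cos θ₂) / (Real.sin θ₁ * Real.sin θ₂)) ^ 3 * Real.sin θ₁)) =
      -(Real.cos θ₂ * omegaSq k m₁ θ₁ θ₂) := by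
    rw [omegaSq, show -Real.cos θ₂ - Real.cos θ₁ = -(Real.cos θ₁ + Real.cos θ₂) by ring,
      add_comm (Real.cos θ₂)]
    field_simp
  rw [k₁, k₂]

theorem smul_xiH (ω : ℝ) : (ω • xiH).1 0 0 = ω / 2 ∧ (ω • xiH).1 0 1 = 0 ∧ (ω • xiH).1 1 0 = 0 := by
  refine ⟨?_, ?_, ?_⟩ <;> simp [xiH, mkSl2]
  ring

theorem smul_xiE (ω : ℝ) :
    (ω • xiE).1 0 0 = 0 ∧ (ω • xiE).1 0 1 = -ω / 2 ∧ (ω • xiE).1 1 0 = ω / 2 := by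
  refine ⟨?_, ?_, ?_⟩ <;> simp [xiE, mkSl2] <;> ring

theorem IsCanonical.isRelEqPair_iff {k m₁ m₂ θ₁ θ₂ : ℝ} {q : Config}
    (h : IsCanonical m₁ m₂ θ₁ θ₂ q) (hk : 0 < k) (hm₁ : 0 < m₁) (hm₂ : 0 < m₂) (ξ : sl2) :
    IsRelEqPair k m₁ m₂ q ξ ↔
      ∃ ω : ℝ, OmegaCondition k m₁ m₂ θ₁ θ₂ ω ∧ (ξ = ω • xiH ∨ ξ = ω • xiE) := by
  rw [HypTwoBody.isRelEqPair_iff hm₁ hm₂, h.balance_iff hk hm₁ hm₂]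
  simp only [h.omegaCondition_iff hm₂]
  constructor
  · rintro ⟨hc, ⟨hb, hW⟩ | ⟨ha, hW⟩⟩
    · refine ⟨_, hW, Or.inl ?_⟩
      obtain ⟨h₀, h₁, h₂⟩ := smul_xiH (2 * ξ.1 0 0)
      exact sl2_ext (by rw [h₀]; ring) (by rw [h₁, hb]) (by rw [h₂, hc, hb, neg_zero])
    -- The sign comes from the upper right entry `-1/2` of `xiE`.
    · refine ⟨-(2 * ξ.1 0 1), by rw [neg_sq, hW], Or.inr ?_⟩
      obtain ⟨h₀, h₁, h₂⟩ := smul_xiE (-(2 * ξ.1 0 1))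
      exact sl2_ext (by rw [h₀, ha]) (by rw [h₁]; ring) (by rw [h₂, hc]; ring)
  · rintro ⟨ω, hW, rfl | rfl⟩
    · obtain ⟨h₀, h₁, h₂⟩ := smul_xiH ω
      rw [h₀, h₁, h₂]
      exact ⟨by ring, Or.inl ⟨rfl, by rw [← hW]; ring⟩⟩
    · obtain ⟨h₀, h₁, h₂⟩ := smul_xiE ω
      rw [h₀, h₁, h₂]
      exact ⟨by ring, Or.inr ⟨rfl, by rw [← hW]; ring⟩⟩

/-! ### Orbits of configurations and canonical configurations -/

/-- The rotation about `i` by the angle `2 φ`. -/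
def rotation (φ : ℝ) : SL(2, ℝ) :=
  ⟨!![Real.cos φ, -Real.sin φ; Real.sin φ, Real.cos φ], by
    rw [Matrix.det_fin_two_of]
    linarith [Real.sin_sq_add_cos_sq φ]⟩

theorem coe_rotation_smul (φ : ℝ) (w : ℍ) : ((rotation φ • w : ℍ) : ℂ) =
    (((Real.cos φ : ℝ) : ℂ) * w + ((-Real.sin φ : ℝ) : ℂ)) /
      (((Real.sin φ : ℝ) : ℂ) * w + ((Real.cos φ : ℝ) : ℂ)) :=
  coe_smul_eq (rotation φ) w

theorem rotation_smul_I (φ : ℝ) : rotation φ • UpperHalfPlane.I = UpperHalfPlane.I := by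
  apply UpperHalfPlane.ext
  have h := denom_ne (rotation φ) UpperHalfPlane.I
  have h' : (((Real.sin φ : ℝ) : ℂ) * Complex.I + ((Real.cos φ : ℝ) : ℂ)) ≠ 0 := h
  rw [coe_rotation_smul, UpperHalfPlane.coe_I, div_eq_iff h']
  push_cast
  linear_combination (-Complex.sin φ) * Complex.I_sq

theorem re_rotation_smul (φ : ℝ) (w : ℍ)
    (h : Real.cos φ * Real.sin φ * (w.re ^ 2 + w.im ^ 2 - 1) +
      (Real.cos φ ^ 2 - Real.sin φ ^ 2) * w.re = 0) : (rotation φ • w).re = 0 := by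
  change ((rotation φ • w : ℍ) : ℂ).re = 0
  rw [coe_rotation_smul, Complex.div_re, ← add_div]
  rw [div_eq_zero_iff]
  left
  simp only [Complex.add_re, Complex.add_im, Complex.re_ofReal_mul, Complex.im_ofReal_mul,
    Complex.ofReal_re, Complex.ofReal_im, coe_re, coe_im]
  linarith

/-- The parameter `π / 2` gives the half turn about `i`, at which the criterion of
`re_rotation_smul` has changed sign; the intermediate value theorem applies. -/
theorem exists_re_rotation_smul_eq_zero (w : ℍ) : ∃ φ, (rotation φ • w).re = 0 := by
  let f : ℝ → ℝ := fun φ => Real.cos φ * Real.sin φ * (w.re ^ 2 + w.im ^ 2 - 1) +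
    (Real.cos φ ^ 2 - Real.sin φ ^ 2) * w.re
  have hf : Continuous f := by fun_prop
  have h0 : f 0 = w.re := by simp [f]
  have h1 : f (Real.pi / 2) = -w.re := by simp [f]
  have hmem : (0 : ℝ) ∈ Set.uIcc (f 0) (f (Real.pi / 2)) := by
    rw [h0, h1, Set.mem_uIcc]
    rcases le_total w.re 0 with h | h
    · left; exact ⟨h, by linarith⟩
    · right; exact ⟨by linarith, h⟩
  obtain ⟨φ, -, hφ⟩ := intermediate_value_uIcc hf.continuousOn hmem
  exact ⟨φ, re_rotation_smul φ w hφ⟩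

theorem exists_smul_eq_normalForm (q : Config) : ∃ g : SL(2, ℝ), (g • q).pos₁ = UpperHalfPlane.I ∧
    (g • q).pos₂.re = 0 ∧ (g • q).pos₂.im = Real.exp (dist q.pos₁ q.pos₂) := by
  obtain ⟨g, hg⟩ := MulAction.exists_smul_eq SL(2, ℝ) q.pos₁ UpperHalfPlane.I
  obtain ⟨φ, hφ⟩ := exists_re_rotation_smul_eq_zero (g • q.pos₂)
  set w := rotation φ • g • q.pos₂ with hw
  have hI : rotation φ • g • q.pos₁ = UpperHalfPlane.I := by rw [hg, rotation_smul_I]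
  have hdist : dist q.pos₁ q.pos₂ = |Real.log w.im| := by
    have h1 : dist (UpperHalfPlane.I) w = dist q.pos₁ q.pos₂ := by
      rw [← hI, hw, dist_smul, dist_smul]
    rw [← h1, dist_of_re_eq (by rw [hφ, UpperHalfPlane.I_re]), UpperHalfPlane.I_im, Real.log_one,
      dist_comm, Real.dist_eq, sub_zero]
  rcases le_total 0 (Real.log w.im) with h | h
  · refine ⟨rotation φ * g, ?_, ?_, ?_⟩
    · rw [pos₁_smul, mul_smul, hI]
    · rw [pos₂_smul, mul_smul, hφ]
    · rw [pos₂_smul, mul_smul, hdist, abs_of_nonneg h, Real.exp_log w.im_pos]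
  -- The second point lies below `i`; the half turn `w ↦ -1/w` moves it above.
  · have hinv : ((rotation (Real.pi / 2) • w : ℍ) : ℂ) = ((w.im⁻¹ : ℝ) : ℂ) * Complex.I := by
      have hy := im_ne_zero' w
      have hwI : (w : ℂ) = ((w.im : ℝ) : ℂ) * Complex.I := by
        apply Complex.ext
        · simpa using hφ
        · simp
      rw [coe_rotation_smul, hwI]
      simp only [Real.cos_pi_div_two, Real.sin_pi_div_two]
      push_cast
      have := Complex.I_ne_zero
      field_simp
      linear_combination (-((w.im : ℝ) : ℂ)) * Complex.I_sq
    refine ⟨rotation (Real.pi / 2) * (rotation φ * g), ?_, ?_, ?_⟩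
    · rw [pos₁_smul, mul_smul, mul_smul, hI, rotation_smul_I]
    · rw [pos₂_smul, mul_smul, mul_smul, ← hw, ← coe_re, hinv]
      simp
    · rw [pos₂_smul, mul_smul, mul_smul, ← hw, ← coe_im, hinv, hdist, abs_of_nonpos h,
        Real.exp_neg, Real.exp_log w.im_pos]
      simp

theorem exists_smul_eq_of_dist_eq {q q' : Config}
    (h : dist q.pos₁ q.pos₂ = dist q'.pos₁ q'.pos₂) : ∃ g : SL(2, ℝ), q = g • q' := by
  obtain ⟨g, h₁, h₂, h₃⟩ := exists_smul_eq_normalForm q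
  obtain ⟨g', h₁', h₂', h₃'⟩ := exists_smul_eq_normalForm q'
  have : g • q = g' • q' := by
    apply Subtype.ext
    apply Prod.ext
    · exact h₁.trans h₁'.symm
    · exact UpperHalfPlane.ext_re_im (h₂.trans h₂'.symm) (by
        change (g • q).pos₂.im = (g' • q').pos₂.im
        rw [h₃, h₃', h])
  exact ⟨g⁻¹ * g', by rw [mul_smul, ← this, inv_smul_smul]⟩

theorem dist_smul_config (g : SL(2, ℝ)) (q : Config) :
    dist (g • q).pos₁ (g • q).pos₂ = dist q.pos₁ q.pos₂ := by
  rw [pos₁_smul, pos₂_smul, dist_smul]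

/-! ### Existence and uniqueness of the balanced division of a segment. -/

theorem strictMono_sinh_balance {m₁ m₂ : ℝ} (hm₁ : 0 < m₁) (hm₂ : 0 < m₂) (d : ℝ) :
    StrictMono fun s => m₁ * Real.sinh (2 * s) - m₂ * Real.sinh (2 * (d - s)) := by
  intro a b hab
  have h₁ : Real.sinh (2 * a) < Real.sinh (2 * b) := Real.sinh_lt_sinh.mpr (by linarith)
  have h₂ : Real.sinh (2 * (d - b)) < Real.sinh (2 * (d - a)) := Real.sinh_lt_sinh.mpr (by linarith)
  have := mul_lt_mul_of_pos_left h₁ hm₁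
  have := mul_lt_mul_of_pos_left h₂ hm₂
  simp only
  linarith

theorem exists_sinh_balance {m₁ m₂ d : ℝ} (hm₁ : 0 < m₁) (hm₂ : 0 < m₂) (hd : 0 < d) :
    ∃ s, 0 < s ∧ s < d ∧ m₁ * Real.sinh (2 * s) = m₂ * Real.sinh (2 * (d - s)) := by
  have hpos : 0 < Real.sinh (2 * d) := Real.sinh_pos_iff.mpr (by linarith)
  have hc : Continuous fun s => m₁ * Real.sinh (2 * s) - m₂ * Real.sinh (2 * (d - s)) := by fun_prop
  have hmem : (0 : ℝ) ∈ Set.Ioo (m₁ * Real.sinh (2 * 0) - m₂ * Real.sinh (2 * (d - 0)))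
      (m₁ * Real.sinh (2 * d) - m₂ * Real.sinh (2 * (d - d))) := by
    simp only [mul_zero, sub_zero, Real.sinh_zero, sub_self]
    exact ⟨by nlinarith, by nlinarith⟩
  obtain ⟨s, hs, h⟩ := intermediate_value_Ioo hd.le hc.continuousOn hmem
  exact ⟨s, hs.1, hs.2, sub_eq_zero.mp h⟩

/-- The angle of the point of the unit circle at distance `s` from `i`. -/
def angle (s : ℝ) : ℝ := Real.arccos (Real.tanh s)

theorem tanh_mem {s : ℝ} (hs : 0 < s) : 0 < Real.tanh s ∧ Real.tanh s < 1 := by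
  have hc := Real.cosh_pos s
  rw [Real.tanh_eq_sinh_div_cosh]
  exact ⟨div_pos (Real.sinh_pos_iff.mpr hs) hc, (div_lt_one hc).mpr (Real.sinh_lt_cosh s)⟩

theorem angle_spec {s : ℝ} (hs : 0 < s) : 0 < angle s ∧ angle s < Real.pi / 2 ∧
    Real.cos (angle s) = Real.sinh s / Real.cosh s ∧ Real.sin (angle s) = 1 / Real.cosh s := by
  obtain ⟨h₁, h₂⟩ := tanh_mem hs
  have hc := Real.cosh_pos s
  refine ⟨Real.arccos_pos.mpr h₂, Real.arccos_lt_pi_div_two.mpr h₁, ?_, ?_⟩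
  · rw [angle, Real.cos_arccos (by linarith) h₂.le, Real.tanh_eq_sinh_div_cosh]
  · rw [angle, Real.sin_arccos, Real.tanh_eq_sinh_div_cosh, Real.sqrt_eq_iff_mul_self_eq_of_pos]
    · field_simp
      linarith [Real.cosh_sq s]
    · positivity

/-- The canonical configuration with given angles. -/
theorem exists_canonical {m₁ m₂ d : ℝ} (hm₁ : 0 < m₁) (hm₂ : 0 < m₂) (hd : 0 < d) :
    ∃ (θ₁ θ₂ : ℝ) (q : Config), IsCanonical m₁ m₂ θ₁ θ₂ q ∧ dist q.pos₁ q.pos₂ = d := by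
  obtain ⟨s, hs, hsd, h⟩ := exists_sinh_balance hm₁ hm₂ hd
  have hs' : 0 < d - s := sub_pos.mpr hsd
  obtain ⟨a₁, a₂, a₃, a₄⟩ := angle_spec hs
  obtain ⟨b₁, b₂, b₃, b₄⟩ := angle_spec hs'
  have c₁ := Real.cosh_pos s
  have c₂ := Real.cosh_pos (d - s)
  have s₁ := Real.sinh_pos_iff.mpr hs
  have s₂ := Real.sinh_pos_iff.mpr hs'
  have p₁ : 0 < Real.cos (angle s) := by rw [a₃]; positivity
  have p₂ : 0 < Real.cos (angle (d - s)) := by rw [b₃]; positivity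
  let z₁ : ℍ := ⟨⟨Real.cos (angle s), Real.sin (angle s)⟩, by
    change 0 < Real.sin (angle s); rw [a₄]; positivity⟩
  let z₂ : ℍ := ⟨⟨-Real.cos (angle (d - s)), Real.sin (angle (d - s))⟩, by
    change 0 < Real.sin (angle (d - s)); rw [b₄]; positivity⟩
  have hne : z₁ ≠ z₂ := by
    intro e
    have : Real.cos (angle s) = -Real.cos (angle (d - s)) := congrArg UpperHalfPlane.re e
    linarith
  let q : Config := ⟨(z₁, z₂), hne⟩
  have hq : IsCanonical m₁ m₂ (angle s) (angle (d - s)) q := by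
    refine ⟨a₁, a₂, b₁, b₂, rfl, rfl, ?_⟩
    rw [a₃, a₄, b₃, b₄]
    rw [Real.sinh_two_mul, Real.sinh_two_mul] at h
    rw [div_eq_div_iff hm₂.ne' (by positivity)]
    field_simp
    linarith
  refine ⟨_, _, q, hq, Real.sinh_injective ?_⟩
  rw [hq.sinh_dist, a₃, a₄, b₃, b₄]
  conv_rhs => rw [← add_sub_cancel s d, Real.sinh_add]
  field_simp

theorem exists_isCanonical_smul {m₁ m₂ : ℝ} (hm₁ : 0 < m₁) (hm₂ : 0 < m₂) (q : Config) :
    ∃ (θ₁ θ₂ : ℝ) (q₀ : Config) (g : SL(2, ℝ)), IsCanonical m₁ m₂ θ₁ θ₂ q₀ ∧ q = g • q₀ := by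
  obtain ⟨θ₁, θ₂, q₀, hq₀, hd⟩ := exists_canonical hm₁ hm₂ (dist_pos_config q)
  obtain ⟨g, hg⟩ := exists_smul_eq_of_dist_eq hd.symm
  exact ⟨θ₁, θ₂, q₀, g, hq₀, hg⟩

theorem cosh_arsinh_cot {θ : ℝ} (h : 0 < Real.sin θ) :
    Real.cosh (Real.arsinh (Real.cos θ / Real.sin θ)) = 1 / Real.sin θ := by
  rw [Real.cosh_arsinh, Real.sqrt_eq_iff_mul_self_eq_of_pos (by positivity)]
  field_simp
  linarith [Real.sin_sq_add_cos_sq θ]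

theorem arsinh_cot_inj {θ θ' : ℝ} (h₁ : 0 < θ) (h₂ : θ < Real.pi / 2) (h₁' : 0 < θ')
    (h₂' : θ' < Real.pi / 2)
    (h : Real.arsinh (Real.cos θ / Real.sin θ) = Real.arsinh (Real.cos θ' / Real.sin θ')) :
    θ = θ' := by
  have hp := Real.pi_pos
  have s := Real.sin_pos_of_pos_of_lt_pi h₁ (by linarith)
  have s' := Real.sin_pos_of_pos_of_lt_pi h₁' (by linarith)
  have hc := congrArg Real.cosh h
  rw [cosh_arsinh_cot s, cosh_arsinh_cot s', one_div, one_div, inv_inj] at hc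
  exact Real.injOn_sin ⟨by linarith, h₂.le⟩ ⟨by linarith, h₂'.le⟩ hc

/-- The distances of the two masses to `i` in a canonical configuration add up to the distance of
the masses, and are balanced. -/
theorem IsCanonical.arsinh_cot {m₁ m₂ θ₁ θ₂ : ℝ} {q : Config} (h : IsCanonical m₁ m₂ θ₁ θ₂ q)
    (hm₂ : 0 < m₂) :
    Real.arsinh (Real.cos θ₂ / Real.sin θ₂) =
      dist q.pos₁ q.pos₂ - Real.arsinh (Real.cos θ₁ / Real.sin θ₁) ∧
    m₁ * Real.sinh (2 * Real.arsinh (Real.cos θ₁ / Real.sin θ₁)) =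
      m₂ * Real.sinh (2 * Real.arsinh (Real.cos θ₂ / Real.sin θ₂)) := by
  obtain ⟨p₁, p₂, p₃, p₄⟩ := h.pos
  constructor
  · rw [eq_sub_iff_add_eq]
    apply Real.sinh_injective
    rw [h.sinh_dist, Real.sinh_add, cosh_arsinh_cot p₂, cosh_arsinh_cot p₄, Real.sinh_arsinh,
      Real.sinh_arsinh]
    field_simp
    ring
  · rw [Real.sinh_two_mul, Real.sinh_two_mul, cosh_arsinh_cot p₂, cosh_arsinh_cot p₄,
      Real.sinh_arsinh, Real.sinh_arsinh]
    field_simp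
    linarith [h.masses hm₂]

/-- Both first distances to `i` are zeros of the same strictly monotone function, which depends only
on the masses and their distance. -/
theorem IsCanonical.angles_unique {m₁ m₂ θ₁ θ₂ θ₁' θ₂' : ℝ} {q q' : Config}
    (h : IsCanonical m₁ m₂ θ₁ θ₂ q) (h' : IsCanonical m₁ m₂ θ₁' θ₂' q') (hm₁ : 0 < m₁)
    (hm₂ : 0 < m₂) (hd : dist q.pos₁ q.pos₂ = dist q'.pos₁ q'.pos₂) : θ₁ = θ₁' ∧ θ₂ = θ₂' := by
  obtain ⟨e, f⟩ := h.arsinh_cot hm₂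
  obtain ⟨e', f'⟩ := h'.arsinh_cot hm₂
  rw [e] at f
  rw [e', ← hd] at f'
  have hs := (strictMono_sinh_balance hm₁ hm₂ (dist q.pos₁ q.pos₂)).injective
    ((sub_eq_zero.mpr f).trans (sub_eq_zero.mpr f').symm)
  refine ⟨arsinh_cot_inj h.1 h.2.1 h'.1 h'.2.1 hs,
    arsinh_cot_inj h.2.2.1 h.2.2.2.1 h'.2.2.1 h'.2.2.2.1 ?_⟩
  rw [e, e', hd, hs]

/-! ### Solutions contained in a group orbit -/

theorem dir_smul (g : SL(2, ℝ)) (x y : ℍ) : dir (g • x) (g • y) = liftCovector g x (dir x y) := by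
  have hd := den_ne_zero g x
  have hd' := conj_den_ne_zero g x
  have he := den_ne_zero g y
  have he' := conj_den_ne_zero g y
  have hx := im_ne_zero' x
  have hy := im_ne_zero' y
  rw [liftCovector_eq, dir, dir, im_smul_den, im_smul_den, coe_smul_sub_coe_smul,
    coe_smul_sub_conj_smul]
  field_simp

theorem sub_conj_ne_zero (x y : ℍ) : (x : ℂ) - (starRingEnd ℂ) (y : ℂ) ≠ 0 := by
  intro h
  have := congrArg Complex.im h
  simp at this
  linarith [x.im_pos, y.im_pos]

theorem dir_ne_zero {x y : ℍ} (h : x ≠ y) : dir x y ≠ 0 :=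
  div_ne_zero (mul_ne_zero (sub_ne_zero.mpr fun e => h (UpperHalfPlane.ext e))
    (sub_conj_ne_zero x y)) (mul_ne_zero (pow_ne_zero 2 (im_ne_zero' x)) (im_ne_zero' y))

/-- The velocity at `x` of an equivariant motion of the pair `(x, y)`. -/
def vel (ρ : ℂ) (x y : ℂ) : ℂ := ρ * ((x - y) * (x - (starRingEnd ℂ) y)) / ((y.im : ℝ) : ℂ)

theorem vel_eq_dir (ρ : ℂ) (x y : ℍ) : vel ρ x y = ρ * (((x.im : ℝ) : ℂ) ^ 2 * dir x y) := by
  have hx := im_ne_zero' x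
  rw [vel, dir, coe_im]
  field_simp

theorem vel_smul (ρ : ℂ) (g : SL(2, ℝ)) (x y : ℍ) :
    vel ρ ((g • x : ℍ) : ℂ) ((g • y : ℍ) : ℂ) = vel ρ x y / den g x ^ 2 := by
  have hd := den_ne_zero g x
  have hd' := conj_den_ne_zero g x
  rw [vel_eq_dir, vel_eq_dir, dir_smul, liftCovector_eq, im_smul_den]
  field_simp

theorem contDiffAt_vel (ρ : ℂ) {w : ℂ × ℂ} (h : w.2.im ≠ 0) :
    ContDiffAt ℝ 1 (fun v : ℂ × ℂ => vel ρ v.1 v.2) w := by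
  have h1 : ContDiffAt ℝ 1 (fun v : ℂ × ℂ => v.1) w := contDiffAt_fst
  have h2 : ContDiffAt ℝ 1 (fun v : ℂ × ℂ => v.2) w := contDiffAt_snd
  have hc : ContDiffAt ℝ 1 (fun v : ℂ × ℂ => (starRingEnd ℂ) v.2) w :=
    Complex.conjCLE.contDiff.contDiffAt.comp w h2
  have hi : ContDiffAt ℝ 1 (fun v : ℂ × ℂ => ((v.2.im : ℝ) : ℂ)) w :=
    (Complex.ofRealCLM.comp Complex.imCLM).contDiff.contDiffAt.comp w h2
  have hinv := hi.inv (Complex.ofReal_ne_zero.mpr h)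
  simp only [vel, div_eq_mul_inv]
  exact (contDiffAt_const.mul ((h1.sub h2).mul (h1.sub hc))).mul hinv

/-- Local Lipschitz uniqueness makes the coincidence set open; it is also closed and nonempty in the
connected line. -/
theorem ode_solution_unique_of_contDiffAt {E : Type*} [NormedAddCommGroup E] [NormedSpace ℝ E]
    {v : E → E} {f g : ℝ → E} {t₀ : ℝ} (hv : ∀ t, ContDiffAt ℝ 1 v (f t))
    (hf : ∀ t, HasDerivAt f (v (f t)) t) (hg : ∀ t, HasDerivAt g (v (g t)) t)
    (h₀ : f t₀ = g t₀) : f = g := by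
  have hfc : Continuous f := continuous_iff_continuousAt.mpr fun t => (hf t).continuousAt
  have hgc : Continuous g := continuous_iff_continuousAt.mpr fun t => (hg t).continuousAt
  have hcl : IsClopen {t | f t = g t} := by
    refine ⟨isClosed_eq hfc hgc, isOpen_iff_mem_nhds.mpr fun t ht => ?_⟩
    obtain ⟨K, s, hs, hK⟩ := (hv t).exists_lipschitzOnWith
    have ht' : f t = g t := ht
    refine ODE_solution_unique_of_eventually (v := fun _ => v) (s := fun _ => s) (K := K)
      (Filter.Eventually.of_forall fun _ => hK) ?_ ?_ ht
    · filter_upwards [hfc.continuousAt.preimage_mem_nhds hs] with r hr using ⟨hf r, hr⟩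
    · filter_upwards [hgc.continuousAt.preimage_mem_nhds (ht' ▸ hs)] with r hr using ⟨hg r, hr⟩
  have := hcl.eq_univ ⟨t₀, h₀⟩
  funext t
  exact this.symm.subset (Set.mem_univ t)

/-- `gradCosh` is `dir` turned by a right angle, so only the imaginary part of `ρ` changes the
distance. -/
theorem pair_gradCosh_vel (ρ : ℂ) (x y : ℍ) :
    pair (gradCosh x y) (vel ρ x y) = -ρ.im / 2 * (x.im ^ 2 * Complex.normSq (dir x y)) := by
  have : pair (gradCosh x y) (vel ρ x y) =
      ((starRingEnd ℂ) (gradCosh x y) * vel ρ x y).re := by simp [pair]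
  rw [this, gradCosh, vel_eq_dir]
  have e : (starRingEnd ℂ) (-(Complex.I / 2) * dir x y) * (ρ * (((x.im : ℝ) : ℂ) ^ 2 * dir x y)) =
      ((x.im ^ 2 * Complex.normSq (dir x y) / 2 : ℝ) : ℂ) * (Complex.I * ρ) := by
    push_cast
    rw [← Complex.mul_conj]
    simp only [map_mul, map_neg, map_div₀, Complex.conj_I, Complex.conj_ofNat]
    ring
  rw [e, Complex.re_ofReal_mul]
  simp
  ring

theorem normSq_dir_symm (x y : ℍ) :
    y.im ^ 2 * Complex.normSq (dir y x) = x.im ^ 2 * Complex.normSq (dir x y) := by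
  have hx := x.im_pos.ne'
  have hy := y.im_pos.ne'
  have h1 : Complex.normSq ((y : ℂ) - x) = Complex.normSq ((x : ℂ) - y) := by
    rw [← neg_sub, Complex.normSq_neg]
  have h2 : Complex.normSq ((y : ℂ) - (starRingEnd ℂ) (x : ℂ)) =
      Complex.normSq ((x : ℂ) - (starRingEnd ℂ) (y : ℂ)) := by
    rw [← Complex.normSq_conj, map_sub, Complex.conj_conj, ← neg_sub, Complex.normSq_neg]
  simp only [dir, map_div₀, map_mul, map_pow, h1, h2, Complex.normSq_ofReal]
  field_simp

theorem im_add_im_eq_zero {q : ℝ → Config} {ρ₁ ρ₂ : ℂ} {t : ℝ} {d : ℝ}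
    (h₁ : HasDerivAt (fun s => ((q s).pos₁ : ℂ)) (vel ρ₁ (q t).pos₁ (q t).pos₂) t)
    (h₂ : HasDerivAt (fun s => ((q s).pos₂ : ℂ)) (vel ρ₂ (q t).pos₂ (q t).pos₁) t)
    (hd : ∀ s, dist (q s).pos₁ (q s).pos₂ = d) : ρ₁.im + ρ₂.im = 0 := by
  have hre : ∀ {f : ℝ → ℂ} {a : ℂ}, HasDerivAt f a t → HasDerivAt (fun s => (f s).re) a.re t :=
    fun h => Complex.reCLM.hasFDerivAt.comp_hasDerivAt t h
  have him : ∀ {f : ℝ → ℂ} {a : ℂ}, HasDerivAt f a t → HasDerivAt (fun s => (f s).im) a.im t :=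
    fun h => Complex.imCLM.hasFDerivAt.comp_hasDerivAt t h
  have h := hasDerivAt_cosh_dist (hre h₁) (him h₁) (hre h₂) (him h₂)
    (p := (q t).pos₁) (q := (q t).pos₂) rfl rfl rfl rfl
  have hc : HasDerivAt (fun _ : ℝ => Real.cosh d) (pair (gradCosh (q t).pos₁ (q t).pos₂)
      (vel ρ₁ (q t).pos₁ (q t).pos₂) + pair (gradCosh (q t).pos₂ (q t).pos₁)
      (vel ρ₂ (q t).pos₂ (q t).pos₁)) t := by
    refine h.congr_of_eventuallyEq (Filter.Eventually.of_forall fun s => ?_)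
    change Real.cosh d = _
    rw [← hd s, cosh_dist_coords]
    rfl
  have e := hc.unique (hasDerivAt_const t _)
  rw [pair_gradCosh_vel, pair_gradCosh_vel, normSq_dir_symm (q t).pos₁] at e
  have hpos : (q t).pos₁.im ^ 2 * Complex.normSq (dir (q t).pos₁ (q t).pos₂) ≠ 0 :=
    mul_ne_zero (pow_ne_zero 2 (q t).pos₁.im_pos.ne')
      (Complex.normSq_eq_zero.not.mpr (dir_ne_zero (q t).2))
  rw [← add_mul, mul_eq_zero, or_iff_left hpos] at e
  linarith

/-- The constraint leaves three real parameters, the dimension of `𝔰𝔩(2, ℝ)`. In the witness, `A` is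
the coefficient of a rotation about `y`, `B` of a rotation about `x`, and `E` of the translation
along the geodesic through both points. -/
theorem exists_quad_eq_vel {ρ₁ ρ₂ : ℂ} (h : ρ₁.im + ρ₂.im = 0) (x y : ℍ) :
    ∃ ξ : sl2, quad ξ x = vel ρ₁ x y ∧ quad ξ y = vel ρ₂ y x := by
  set A := ρ₁.re / y.im with hA
  set B := ρ₂.re / x.im with hB
  set E := ρ₁.im / (2 * x.im * y.im) with hE
  set n₁ := x.re ^ 2 + x.im ^ 2 with hn₁
  set n₂ := y.re ^ 2 + y.im ^ 2 with hn₂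
  refine ⟨mkSl2 (-A * y.re - B * x.re + E * (n₂ - n₁))
    (A * n₂ + B * n₁ + 2 * E * (y.re * n₁ - x.re * n₂)) (-(A + B + 2 * E * (x.re - y.re))), ?_, ?_⟩
  all_goals
    have hx := x.im_pos.ne'
    have hy := y.im_pos.ne'
    have hq : ∀ a b c : ℝ, ∀ w : ℍ, quad (mkSl2 a b c) w =
        ⟨b + 2 * a * w.re - c * (w.re ^ 2 - w.im ^ 2), 2 * a * w.im - 2 * c * w.re * w.im⟩ := by
      intro a b c w
      apply Complex.ext <;> simp [quad, mkSl2, pow_two]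
      ring
    have hv : ∀ (ρ : ℂ) (x y : ℍ), vel ρ x y =
        ⟨(ρ.re * ((x.re - y.re) ^ 2 - x.im ^ 2 + y.im ^ 2) - ρ.im * (2 * (x.re - y.re) * x.im)) /
            y.im,
          (ρ.re * (2 * (x.re - y.re) * x.im) + ρ.im * ((x.re - y.re) ^ 2 - x.im ^ 2 + y.im ^ 2)) /
            y.im⟩ := by
      intro ρ x y
      rw [vel]
      apply Complex.ext
      · rw [coe_im, Complex.div_ofReal_re]
        congr 1
        simp
        ring
      · rw [coe_im, Complex.div_ofReal_im]
        congr 1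
        simp
        ring
    have h' : ρ₂.im = -ρ₁.im := by linarith
    rw [hq, hv]
    apply Complex.ext <;> simp only [hA, hB, hE, hn₁, hn₂, h'] <;> field_simp <;> ring

/-- A nonzero field `quad` has at most one zero in the half plane, since `c ≠ 0` and the zero's real
part and modulus are determined by the coefficients. -/
theorem quad_injective {ξ η : sl2} {x y : ℍ} (hxy : x ≠ y) (hx : quad ξ x = quad η x)
    (hy : quad ξ y = quad η y) : ξ = η := by
  have key : ∀ w : ℍ, quad ξ w = quad η w →
      ξ.1 0 0 - η.1 0 0 = (ξ.1 1 0 - η.1 1 0) * w.re ∧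
        ξ.1 0 1 - η.1 0 1 = -(ξ.1 1 0 - η.1 1 0) * (w.re ^ 2 + w.im ^ 2) := by
    intro w hw
    have h1 := congrArg Complex.re hw
    have h2 := congrArg Complex.im hw
    simp [quad, pow_two] at h1 h2
    have h3 : ξ.1 0 0 - η.1 0 0 = (ξ.1 1 0 - η.1 1 0) * w.re :=
      mul_left_cancel₀ w.im_pos.ne' (by linear_combination h2 / 2)
    exact ⟨h3, by linear_combination h1 - 2 * w.re * h3⟩
  obtain ⟨a₁, b₁⟩ := key x hx
  obtain ⟨a₂, b₂⟩ := key y hy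
  have hc : ξ.1 1 0 - η.1 1 0 = 0 := by
    by_contra hne
    apply hxy
    have hre : x.re = y.re := mul_left_cancel₀ hne (a₁.symm.trans a₂)
    have hn := mul_left_cancel₀ (neg_ne_zero.mpr hne) (b₁.symm.trans b₂)
    rw [hre] at hn
    exact UpperHalfPlane.ext_re_im hre
      ((sq_eq_sq₀ x.im_pos.le y.im_pos.le).mp (add_left_cancel hn))
  rw [hc] at a₁ b₁
  exact sl2_ext (by linarith) (by linarith) (by linarith)

theorem motion_zero (m₁ m₂ : ℝ) (q : Config) (ξ : sl2) :
    motion m₁ m₂ q ξ 0 = momentumOf m₁ m₂ q ξ := by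
  rw [motion_eq, expSL_zero_smul, one_smul]

theorem motion_injective {m₁ m₂ : ℝ} (hm₁ : 0 < m₁) (hm₂ : 0 < m₂) {q q' : Config} {ξ ξ' : sl2}
    (h : motion m₁ m₂ q ξ = motion m₁ m₂ q' ξ') : q = q' ∧ ξ = ξ' := by
  have h0 := congrFun h 0
  rw [motion_zero, motion_zero] at h0
  obtain rfl : q = q' := congrArg Phase.q h0
  have h1 := congrArg Phase.p₁ h0
  have h2 := congrArg Phase.p₂ h0
  simp only [momentumOf, generator_eq] at h1 h2
  have hc : ∀ (m : ℝ) (x : ℍ), 0 < m → ((m / x.im ^ 2 : ℝ) : ℂ) ≠ 0 := fun m x hm =>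
    Complex.ofReal_ne_zero.mpr (div_pos hm (pow_pos x.im_pos 2)).ne'
  exact ⟨rfl, quad_injective q.2 (mul_left_cancel₀ (hc _ _ hm₁) h1)
    (mul_left_cancel₀ (hc _ _ hm₂) h2)⟩

theorem exists_eq_motion {k m₁ m₂ : ℝ} (hm₁ : 0 < m₁) (hm₂ : 0 < m₂) {z : ℝ → Phase}
    (hz : IsRelativeEquilibrium k m₁ m₂ z) : ∃ q ξ, z = motion m₁ m₂ q ξ := by
  obtain ⟨hsol, z₀, horb⟩ := hz
  rw [isSolution_iff] at hsol
  have hm₁c : (m₁ : ℂ) ≠ 0 := Complex.ofReal_ne_zero.mpr hm₁.ne'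
  have hm₂c : (m₂ : ℂ) ≠ 0 := Complex.ofReal_ne_zero.mpr hm₂.ne'
  -- Momentum and `dir` are multiplied by the same complex factor under the group, so this ratio is
  -- constant on the orbit.
  set ρ₁ := z₀.p₁ / dir z₀.q.pos₁ z₀.q.pos₂ / m₁ with hρ₁
  set ρ₂ := z₀.p₂ / dir z₀.q.pos₂ z₀.q.pos₁ / m₂ with hρ₂
  have hd₁ := dir_ne_zero z₀.q.2
  have hd₂ := dir_ne_zero (Ne.symm z₀.q.2)
  have hdist : ∀ t, dist (z t).q.pos₁ (z t).q.pos₂ = dist z₀.q.pos₁ z₀.q.pos₂ := by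
    intro t
    obtain ⟨g, hg⟩ := horb t
    rw [← hg]
    exact dist_smul_config g z₀.q
  have hp₁ : ∀ t, (z t).p₁ = m₁ * ρ₁ * dir (z t).q.pos₁ (z t).q.pos₂ := by
    intro t
    obtain ⟨g, hg⟩ := horb t
    rw [← hg]
    change liftCovector g z₀.q.pos₁ z₀.p₁ = m₁ * ρ₁ * dir (g • z₀.q.pos₁) (g • z₀.q.pos₂)
    rw [dir_smul, liftCovector_eq, liftCovector_eq, hρ₁]
    have : dir z₀.q.pos₁ z₀.q.pos₂ ≠ 0 := hd₁
    field_simp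
  have hp₂ : ∀ t, (z t).p₂ = m₂ * ρ₂ * dir (z t).q.pos₂ (z t).q.pos₁ := by
    intro t
    obtain ⟨g, hg⟩ := horb t
    rw [← hg]
    change liftCovector g z₀.q.pos₂ z₀.p₂ = m₂ * ρ₂ * dir (g • z₀.q.pos₂) (g • z₀.q.pos₁)
    rw [dir_smul, liftCovector_eq, liftCovector_eq, hρ₂]
    have : dir z₀.q.pos₂ z₀.q.pos₁ ≠ 0 := hd₂
    field_simp
  have hv₁ : ∀ t, HasDerivAt (fun s => ((z s).q.pos₁ : ℂ))
      (vel ρ₁ (z t).q.pos₁ (z t).q.pos₂) t := by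
    intro t
    refine (hasDerivAt_coords.mp (hsol t)).1.1.congr_deriv ?_
    rw [vel_eq_dir]
    simp only [hamField, hp₁]
    push_cast
    field_simp
  have hv₂ : ∀ t, HasDerivAt (fun s => ((z s).q.pos₂ : ℂ))
      (vel ρ₂ (z t).q.pos₂ (z t).q.pos₁) t := by
    intro t
    refine (hasDerivAt_coords.mp (hsol t)).1.2.congr_deriv ?_
    rw [vel_eq_dir]
    simp only [hamField, hp₂]
    push_cast
    field_simp
  -- The distance is constant on an orbit, which supplies the constraint needed to find `ξ`. Only
  -- the velocity half of Hamilton's equations enters.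
  have him := im_add_im_eq_zero (q := fun s => (z s).q) (hv₁ 0) (hv₂ 0) hdist
  obtain ⟨ξ, hξ₁, hξ₂⟩ := exists_quad_eq_vel him (z 0).q.pos₁ (z 0).q.pos₂
  have hquad : ∀ (t : ℝ) (x : ℍ), quad ξ ((expSL (t • ξ) • x : ℍ) : ℂ) = quad ξ x / den (expSL (t • ξ)) x ^ 2 := by
    intro t x
    have h := quad_Ad (expSL (t • ξ)) ξ x
    rwa [Ad_expSL_self] at h
  set F : ℂ × ℂ → ℂ × ℂ := fun w => (vel ρ₁ w.1 w.2, vel ρ₂ w.2 w.1) with hF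
  have hFc : ∀ q : Config, ContDiffAt ℝ 1 F ((q.pos₁ : ℂ), (q.pos₂ : ℂ)) := by
    intro q
    refine (contDiffAt_vel ρ₁ (w := ((q.pos₁ : ℂ), (q.pos₂ : ℂ))) q.pos₂.im_pos.ne').prodMk ?_
    exact (contDiffAt_vel ρ₂ (w := ((q.pos₂ : ℂ), (q.pos₁ : ℂ))) q.pos₁.im_pos.ne').comp
      (f := fun w : ℂ × ℂ => (w.2, w.1)) ((q.pos₁ : ℂ), (q.pos₂ : ℂ))
      (contDiffAt_snd.prodMk contDiffAt_fst)
  have heq : (fun t => (((z t).q.pos₁ : ℂ), ((z t).q.pos₂ : ℂ))) = fun t =>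
      (((expSL (t • ξ) • (z 0).q.pos₁ : ℍ) : ℂ), ((expSL (t • ξ) • (z 0).q.pos₂ : ℍ) : ℂ)) := by
    refine ode_solution_unique_of_contDiffAt (v := F) (t₀ := 0) (fun t => hFc _)
      (fun t => (hv₁ t).prodMk (hv₂ t)) (fun t => ?_) ?_
    · refine ((hasDerivAt_expSL_smul ξ (z 0).q.pos₁ t).prodMk
        (hasDerivAt_expSL_smul ξ (z 0).q.pos₂ t)).congr_deriv ?_
      simp only [hF]
      -- `quad ξ` along its own flow and `vel` scale by the same factor, so their agreement at time
      -- zero persists.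
      rw [hquad, hquad, vel_smul, vel_smul, hξ₁, hξ₂]
    · simp only [expSL_zero_smul, one_smul]
  have hq : ∀ t, (z t).q = expSL (t • ξ) • (z 0).q := by
    intro t
    have h := congrFun heq t
    exact Subtype.ext (Prod.ext (UpperHalfPlane.ext (congrArg Prod.fst h))
      (UpperHalfPlane.ext (congrArg Prod.snd h)))
  refine ⟨(z 0).q, ξ, funext fun t => ?_⟩
  have e₁ : quad ξ (z t).q.pos₁ = vel ρ₁ (z t).q.pos₁ (z t).q.pos₂ := by
    rw [hq t, pos₁_smul, pos₂_smul, hquad, vel_smul, hξ₁]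
  have e₂ : quad ξ (z t).q.pos₂ = vel ρ₂ (z t).q.pos₂ (z t).q.pos₁ := by
    rw [hq t, pos₁_smul, pos₂_smul, hquad, vel_smul, hξ₂]
  rw [motion_eq, ← hq t]
  refine Phase.ext rfl ?_ ?_
  · have hy := im_ne_zero' (z t).q.pos₁
    simp only [momentumOf, generator_eq]
    rw [e₁, vel_eq_dir, hp₁]
    push_cast
    field_simp
  · have hy := im_ne_zero' (z t).q.pos₂
    simp only [momentumOf, generator_eq]
    rw [e₂, vel_eq_dir, hp₂]
    push_cast
    field_simp

theorem isRelativeEquilibrium_iff {k m₁ m₂ : ℝ} (hm₁ : 0 < m₁) (hm₂ : 0 < m₂) (z : ℝ → Phase) :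
    IsRelativeEquilibrium k m₁ m₂ z ↔ ∃! x : Config × sl2,
      IsRelEqPair k m₁ m₂ x.1 x.2 ∧ z = motion m₁ m₂ x.1 x.2 := by
  constructor
  · intro hz
    obtain ⟨q, ξ, rfl⟩ := exists_eq_motion hm₁ hm₂ hz
    refine ⟨(q, ξ), ⟨hz.1, rfl⟩, fun x hx => ?_⟩
    obtain ⟨h₁, h₂⟩ := motion_injective hm₁ hm₂ hx.2
    exact Prod.ext h₁.symm h₂.symm
  · rintro ⟨x, ⟨h, rfl⟩, -⟩
    exact ⟨h, momentumOf m₁ m₂ x.1 x.2, fun t => ⟨_, rfl⟩⟩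

/-! ### The two families -/

theorem isRelEqPair_smul {k m₁ m₂ : ℝ} (hm₁ : 0 < m₁) (hm₂ : 0 < m₂) (g : SL(2, ℝ)) (q : Config)
    (ξ : sl2) : IsRelEqPair k m₁ m₂ (g • q) (Ad g ξ) ↔ IsRelEqPair k m₁ m₂ q ξ := by
  rw [isRelEqPair_iff hm₁ hm₂, isRelEqPair_iff hm₁ hm₂, balance_smul]

theorem isRelEqPair_iff_mem_family {k m₁ m₂ : ℝ} (hk : 0 < k) (hm₁ : 0 < m₁) (hm₂ : 0 < m₂)
    (q : Config) (ξ : sl2) : IsRelEqPair k m₁ m₂ q ξ ↔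
      (q, ξ) ∈ relEqFamily k m₁ m₂ xiH ∨ (q, ξ) ∈ relEqFamily k m₁ m₂ xiE := by
  constructor
  · intro h
    obtain ⟨θ₁, θ₂, q₀, g, hq₀, rfl⟩ := exists_isCanonical_smul hm₁ hm₂ q
    have hξ : ξ = Ad g (Ad g⁻¹ ξ) := by rw [← Ad_mul, mul_inv_cancel, Ad_one]
    rw [hξ, isRelEqPair_smul hm₁ hm₂, hq₀.isRelEqPair_iff hk hm₁ hm₂] at h
    obtain ⟨ω, hω, h | h⟩ := h
    · exact Or.inl ⟨θ₁, θ₂, ω, q₀, g, hq₀, hω, by rw [← h, ← hξ]⟩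
    · exact Or.inr ⟨θ₁, θ₂, ω, q₀, g, hq₀, hω, by rw [← h, ← hξ]⟩
  · rintro (⟨θ₁, θ₂, ω, q₀, g, hq₀, hω, h⟩ | ⟨θ₁, θ₂, ω, q₀, g, hq₀, hω, h⟩)
    · obtain ⟨rfl, rfl⟩ := Prod.mk.inj h
      rw [isRelEqPair_smul hm₁ hm₂, hq₀.isRelEqPair_iff hk hm₁ hm₂]
      exact ⟨ω, hω, Or.inl rfl⟩
    · obtain ⟨rfl, rfl⟩ := Prod.mk.inj h
      rw [isRelEqPair_smul hm₁ hm₂, hq₀.isRelEqPair_iff hk hm₁ hm₂]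
      exact ⟨ω, hω, Or.inr rfl⟩

theorem discr_sl2 (ξ : sl2) : ξ.1.discr = 4 * (ξ.1 0 0 ^ 2 + ξ.1 0 1 * ξ.1 1 0) := by
  rw [Matrix.discr_fin_two, trace_sl2, Matrix.det_fin_two, sl2_apply_one_one]
  ring

theorem isHyperbolic_of_mem {k m₁ m₂ : ℝ} (hk : 0 < k) (hm₁ : 0 < m₁) (hm₂ : 0 < m₂)
    {x : Config × sl2} (hx : x ∈ relEqFamily k m₁ m₂ xiH) : x.2.1.IsHyperbolic := by
  obtain ⟨θ₁, θ₂, ω, q₀, g, hq₀, hω, rfl⟩ := hx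
  rw [hq₀.omegaCondition_iff hm₂] at hω
  have hpos := hω.symm ▸ hq₀.omegaSq_pos hk hm₁
  obtain ⟨h₀, h₁, h₂⟩ := smul_xiH ω
  rw [isHyperbolic_Ad, Matrix.IsHyperbolic, discr_sl2, h₀, h₁, h₂]
  nlinarith

theorem isElliptic_of_mem {k m₁ m₂ : ℝ} (hk : 0 < k) (hm₁ : 0 < m₁) (hm₂ : 0 < m₂)
    {x : Config × sl2} (hx : x ∈ relEqFamily k m₁ m₂ xiE) : x.2.1.IsElliptic := by
  obtain ⟨θ₁, θ₂, ω, q₀, g, hq₀, hω, rfl⟩ := hx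
  rw [hq₀.omegaCondition_iff hm₂] at hω
  have hpos := hω.symm ▸ hq₀.omegaSq_pos hk hm₁
  obtain ⟨h₀, h₁, h₂⟩ := smul_xiE ω
  rw [isElliptic_Ad, Matrix.IsElliptic, discr_sl2, h₀, h₁, h₂]
  nlinarith

theorem exists_mem_family {k m₁ m₂ : ℝ} (hk : 0 < k) (hm₁ : 0 < m₁) (hm₂ : 0 < m₂) (η : sl2)
    (q : Config) : ∃ ξ, (q, ξ) ∈ relEqFamily k m₁ m₂ η := by
  obtain ⟨θ₁, θ₂, q₀, g, hq₀, rfl⟩ := exists_isCanonical_smul hm₁ hm₂ q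
  refine ⟨_, θ₁, θ₂, Real.sqrt (omegaSq k m₁ θ₁ θ₂), q₀, g, hq₀, ?_, rfl⟩
  rw [hq₀.omegaCondition_iff hm₂, Real.sq_sqrt (hq₀.omegaSq_pos hk hm₁).le]

/-- The matrix is symmetric with zero diagonal: it translates along the unit circle, the geodesic of
both masses, and has no acceleration there. Algebraically, `c = b` contradicts `c = -b` unless `ω =
0`, and rest is excluded by the positive force. -/
theorem not_isRelEqPair_xiE_add_xiP {k m₁ m₂ θ₁ θ₂ : ℝ} (hk : 0 < k) (hm₁ : 0 < m₁) (hm₂ : 0 < m₂)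
    {q : Config} (hq : IsCanonical m₁ m₂ θ₁ θ₂ q) (ω : ℝ) :
    ¬ IsRelEqPair k m₁ m₂ q (ω • (xiE + xiP)) := by
  rw [isRelEqPair_iff hm₁ hm₂, hq.balance_iff hk hm₁ hm₂]
  have hpos := hq.omegaSq_pos hk hm₁
  have h₀ : (ω • (xiE + xiP)).1 0 0 = 0 := by simp [xiE, xiP, mkSl2]
  have h₁ : (ω • (xiE + xiP)).1 0 1 = ω / 2 := by simp [xiE, xiP, mkSl2]; ring
  have h₂ : (ω • (xiE + xiP)).1 1 0 = ω / 2 := by simp [xiE, xiP, mkSl2]; ring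
  rw [h₀, h₁, h₂]
  rintro ⟨h, ⟨-, h'⟩ | ⟨-, h'⟩⟩
  · rw [← h'] at hpos
    norm_num at hpos
  · have : ω = 0 := by linarith
    rw [← h', this] at hpos
    norm_num at hpos

end HypTwoBody

end

theorem mainTheorem1 (k m₁ m₂ : ℝ) (hk : 0 < k) (hm₁ : 0 < m₁) (hm₂ : 0 < m₂) :
    -- relative equilibria correspond to pairs `(q, ξ)`
    (∀ z : ℝ → HypTwoBody.Phase, HypTwoBody.IsRelativeEquilibrium k m₁ m₂ z ↔
      ∃! x : HypTwoBody.Config × HypTwoBody.sl2,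
        HypTwoBody.IsRelEqPair k m₁ m₂ x.1 x.2 ∧ z = HypTwoBody.motion m₁ m₂ x.1 x.2) ∧
    -- up to `SL(2, ℝ)`, every configuration is in a unique canonical configuration
    (∀ q : HypTwoBody.Config, ∃! θ : ℝ × ℝ, ∃ (q₀ : HypTwoBody.Config) (g : SL(2, ℝ)),
      HypTwoBody.IsCanonical m₁ m₂ θ.1 θ.2 q₀ ∧ q = g • q₀) ∧
    -- the relative equilibria in a canonical configuration
    (∀ (θ₁ θ₂ : ℝ) (q : HypTwoBody.Config), HypTwoBody.IsCanonical m₁ m₂ θ₁ θ₂ q →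
      ∀ ξ : HypTwoBody.sl2, HypTwoBody.IsRelEqPair k m₁ m₂ q ξ ↔
        ∃ ω : ℝ, HypTwoBody.OmegaCondition k m₁ m₂ θ₁ θ₂ ω ∧
          (ξ = ω • HypTwoBody.xiH ∨ ξ = ω • HypTwoBody.xiE)) ∧
    -- all relative equilibria lie in exactly two families
    (∀ (q : HypTwoBody.Config) (ξ : HypTwoBody.sl2), HypTwoBody.IsRelEqPair k m₁ m₂ q ξ ↔
      (q, ξ) ∈ HypTwoBody.relEqFamily k m₁ m₂ HypTwoBody.xiH ∨
      (q, ξ) ∈ HypTwoBody.relEqFamily k m₁ m₂ HypTwoBody.xiE) ∧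
    Disjoint (HypTwoBody.relEqFamily k m₁ m₂ HypTwoBody.xiH)
      (HypTwoBody.relEqFamily k m₁ m₂ HypTwoBody.xiE) ∧
    -- both families contain relative equilibria in every configuration
    (∀ q : HypTwoBody.Config,
      (∃ ξ, (q, ξ) ∈ HypTwoBody.relEqFamily k m₁ m₂ HypTwoBody.xiH) ∧
      (∃ ξ, (q, ξ) ∈ HypTwoBody.relEqFamily k m₁ m₂ HypTwoBody.xiE)) ∧
    -- the velocities in the two families are hyperbolic and elliptic, respectively
    (∀ x ∈ HypTwoBody.relEqFamily k m₁ m₂ HypTwoBody.xiH,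
      (x.2 : Matrix (Fin 2) (Fin 2) ℝ).IsHyperbolic) ∧
    (∀ x ∈ HypTwoBody.relEqFamily k m₁ m₂ HypTwoBody.xiE,
      (x.2 : Matrix (Fin 2) (Fin 2) ℝ).IsElliptic) ∧
    -- no parabolic velocities
    (∀ (q : HypTwoBody.Config) (ξ : HypTwoBody.sl2),
      (ξ : Matrix (Fin 2) (Fin 2) ℝ).IsParabolic → ¬ HypTwoBody.IsRelEqPair k m₁ m₂ q ξ) ∧
    -- no velocity `ω (ξ_e + ξ_p)` in a canonical configuration
    (∀ (θ₁ θ₂ : ℝ) (q : HypTwoBody.Config), HypTwoBody.IsCanonical m₁ m₂ θ₁ θ₂ q →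
      ∀ ω : ℝ, ¬ HypTwoBody.IsRelEqPair k m₁ m₂ q
        (ω • (HypTwoBody.xiE + HypTwoBody.xiP))) := by
  refine ⟨fun z => HypTwoBody.isRelativeEquilibrium_iff hm₁ hm₂ z, fun q => ?_,
    fun θ₁ θ₂ q hq ξ => hq.isRelEqPair_iff hk hm₁ hm₂ ξ,
    fun q ξ => HypTwoBody.isRelEqPair_iff_mem_family hk hm₁ hm₂ q ξ,
    Set.disjoint_left.mpr fun x hH hE => ?_,
    fun q => ⟨HypTwoBody.exists_mem_family hk hm₁ hm₂ _ q,
      HypTwoBody.exists_mem_family hk hm₁ hm₂ _ q⟩,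
    fun x hx => HypTwoBody.isHyperbolic_of_mem hk hm₁ hm₂ hx,
    fun x hx => HypTwoBody.isElliptic_of_mem hk hm₁ hm₂ hx, fun q ξ hξ h => ?_,
    fun θ₁ θ₂ q hq ω => HypTwoBody.not_isRelEqPair_xiE_add_xiP hk hm₁ hm₂ hq ω⟩
  · obtain ⟨θ₁, θ₂, q₀, g, hq₀, hq⟩ := HypTwoBody.exists_isCanonical_smul hm₁ hm₂ q
    refine ⟨(θ₁, θ₂), ⟨q₀, g, hq₀, hq⟩, ?_⟩
    rintro ⟨θ₁', θ₂'⟩ ⟨q₀', g', hq₀', hq'⟩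
    -- Two canonical representatives of `q` have equal distances, and the distance determines the
    -- angles.
    have hd := HypTwoBody.dist_smul_config g q₀
    rw [← hq, hq', HypTwoBody.dist_smul_config] at hd
    obtain ⟨h₁, h₂⟩ := hq₀'.angles_unique hq₀ hm₁ hm₂ hd
    exact Prod.ext h₁ h₂
  -- A common element would have a discriminant both positive and negative.
  · exact (HypTwoBody.isHyperbolic_of_mem hk hm₁ hm₂ hH).not_gt
      (HypTwoBody.isElliptic_of_mem hk hm₁ hm₂ hE)
  · rcases (HypTwoBody.isRelEqPair_iff_mem_family hk hm₁ hm₂ q ξ).mp h with h | h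
    · exact (HypTwoBody.isHyperbolic_of_mem hk hm₁ hm₂ h).ne' hξ.2
    · exact (HypTwoBody.isElliptic_of_mem hk hm₁ hm₂ h).ne hξ.2
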